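/- Let $d\ge 0$ and let $\mathcal X=\mathbb R^d$ (with Lebesgue measure) or $\mathcal X=\mathbb Z^d$ (with counting measure), $\mathcal H=L^2(\mathcal X)$. Let $V:\mathcal X\to\mathbb R$ be (essentially) bounded, and let $H=-\Delta+V$ be the Schrödinger operator, self-adjoint on $H^2(\mathbb R^d)$ if $\mathcal X=\mathbb R^d$ and on all of $\ell^2(\mathbb Z^d)$ if $\mathcal X=\mathbb Z^d$. Let $\mathcal H_{ac}$ be the set of vectors whose spectral measure for $H$ is absolutely continuous, and $\mathcal H_{pp}$ the closed linear span of the eigenvectors of $H$. Let $Q\psi=(q_1\psi,\dots,q_d\psi)$ be the position operator $\mathcal H\to\mathcal H^d$ with its maximal domain $D(Q)=\{\psi\in\mathcal H: q_j\psi\in\mathcal H \text{ for all } j\}$, and $Q(t)=e^{itH}Qe^{-itH}$ with domain $\{\psi: e^{-itH}\psi\in D(Q)\}$. We say that $\psi\in\mathcal H$ has asymptotic velocity $P\in\mathcal H^d$ if $\psi\in D(Q(t))$ for all sufficiently large $t$ and $\frac{1}{t}Q(t)\psi\to P$ in $\mathcal H^d$ as $t\to\infty$, and that $\psi$ exhibits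 strong ballistic transport if it has a nonzero asymptotic velocity. Let $\psi\in\mathcal H_{ac}$ exhibit strong ballistic transport, and let $\varphi\in\mathcal H_{pp}\cap D(Q)\cap D(H)$. Then $\psi+\varphi$ exhibits strong ballistic transport, with the same asymptotic velocity: if $\frac1tQ(t)\psi\to P_\psi$, then $\frac1tQ(t)(\psi+\varphi)\to P_\psi$ as $t\to\infty$. -/

import Mathlib

open MeasureTheory Filter Topology
open scoped ENNReal Laplacian

noncomputable section

namespace BallisticTransport

section Abstract

variable {E : Type*} [NormedAddCommGroup E] [InnerProductSpace ℂ E] [CompleteSpace E]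

/-- A strongly continuous one-parameter unitary group on a complex Hilbert space. (Isometry and
the group law make every `U t` unitary, with inverse `U (-t)`.) -/
structure IsUnitaryGroup (U : ℝ → E →L[ℂ] E) : Prop where
  zero : U 0 = 1
  add : ∀ s t, U (s + t) = (U s).comp (U t)
  norm_map : ∀ t ψ, ‖U t ψ‖ = ‖ψ‖
  continuous : ∀ ψ, Continuous fun t => U t ψ

/-- `U t = e^{-itH}`: the unitary group `U` has the generator `-iH`, that is, the vectors `ψ` along
which `t ↦ U t ψ` is differentiable at `0` are those of the domain of `H`, and
`i ∂ₜ (U t ψ) = H ψ` at `t = 0` for them. -/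
structure IsPropagator (H : E →ₗ.[ℂ] E) (U : ℝ → E →L[ℂ] E) : Prop where
  isUnitaryGroup : IsUnitaryGroup U
  generator : ∀ ψ η : E,
    HasDerivAt (fun t => U t ψ) (-Complex.I • η) 0 ↔ ∃ h : ψ ∈ H.domain, H ⟨ψ, h⟩ = η

open Classical in
/-- The propagator `e^{-itH}` of a self-adjoint operator `H`. For self-adjoint `H`, there is exactly
one `U` with `IsPropagator H U`, by Stone's theorem. If `H` is not self-adjoint there is none,
and the value is the junk value `0`. -/
def propagator (H : E →ₗ.[ℂ] E) : ℝ → E →L[ℂ] E :=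
  if h : ∃ U, IsPropagator H U then h.choose else 0

/-- `ℋ_pp`: the closed linear span of the eigenvectors of `H`. -/
def purePointSubspace (H : E →ₗ.[ℂ] E) : Submodule ℂ E :=
  (Submodule.span ℂ {φ : E | ∃ (l : ℝ) (h : φ ∈ H.domain),
    H ⟨φ, h⟩ = (l : ℂ) • φ}).topologicalClosure

/-- `m` is the spectral measure of `ψ` for `H`: the finite Borel measure on `ℝ` with
`⟨ψ, e^{-itH} ψ⟩ = ∫ e^{-itl} dm(l)` for all real `t` (a finite measure is determined by its
Fourier transform). -/
def IsSpectralMeasure (H : E →ₗ.[ℂ] E) (ψ : E) (m : Measure ℝ) : Prop :=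
  IsFiniteMeasure m ∧
    ∀ t : ℝ, inner ℂ ψ (propagator H t ψ) = ∫ l : ℝ, Complex.exp (-Complex.I * t * l) ∂m

/-- `ℋ_ac`: the vectors whose spectral measure is absolutely continuous with respect to Lebesgue
measure. -/
def absolutelyContinuousSubspace (H : E →ₗ.[ℂ] E) : Set E :=
  {ψ | ∃ m : Measure ℝ, IsSpectralMeasure H ψ m ∧ m ≪ volume}

variable {d : ℕ}

/-- The Heisenberg evolution `A(t) = e^{itH} A e^{-itH}` of an operator `A` from `ℋ` to `ℋᵈ`,
on its natural domain `{ψ | e^{-itH} ψ ∈ D(A)}`; `e^{itH}` acts on `ℋᵈ` componentwise. -/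
def heisenberg (H : E →ₗ.[ℂ] E) (A : E →ₗ.[ℂ] PiLp 2 (fun _ : Fin d => E)) (t : ℝ) :
    E →ₗ.[ℂ] PiLp 2 (fun _ : Fin d => E) where
  domain := A.domain.comap (propagator H t : E →ₗ[ℂ] E)
  toFun :=
    { toFun := fun ψ =>
        WithLp.toLp 2 fun j => propagator H (-t) (A ⟨propagator H t ψ.1, ψ.2⟩ j)
      map_add' := by
        intro ψ φ
        have h : (⟨propagator H t (ψ + φ).1, (ψ + φ).2⟩ : A.domain)
            = ⟨propagator H t ψ.1, ψ.2⟩ + ⟨propagator H t φ.1, φ.2⟩ :=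
          Subtype.ext (map_add (propagator H t) ψ.1 φ.1)
        ext j : 1
        simp only [h, A.map_add, PiLp.add_apply, map_add]
      map_smul' := by
        intro c ψ
        have h : (⟨propagator H t (c • ψ).1, (c • ψ).2⟩ : A.domain)
            = c • ⟨propagator H t ψ.1, ψ.2⟩ :=
          Subtype.ext (map_smul (propagator H t) c ψ.1)
        ext j : 1
        simp only [h, A.map_smul, PiLp.smul_apply, map_smul, RingHom.id_apply] }

/-- `ψ` has the asymptotic velocity `P`: as `t → ∞`, eventually `ψ ∈ D(Q(t))`, and
`Q(t) ψ / t → P` in `ℋᵈ`. -/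
def HasAsymptoticVelocity (H : E →ₗ.[ℂ] E) (Q : E →ₗ.[ℂ] PiLp 2 (fun _ : Fin d => E))
    (ψ : E) (P : PiLp 2 (fun _ : Fin d => E)) : Prop :=
  ∀ ε : ℝ, 0 < ε → ∀ᶠ t : ℝ in atTop, ∃ h : ψ ∈ (heisenberg H Q t).domain,
    ‖((t : ℂ)⁻¹) • heisenberg H Q t ⟨ψ, h⟩ - P‖ < ε

/-- Strong ballistic transport: `ψ` has a nonzero asymptotic velocity. -/
def StrongBallisticTransport (H : E →ₗ.[ℂ] E) (Q : E →ₗ.[ℂ] PiLp 2 (fun _ : Fin d => E))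
    (ψ : E) : Prop :=
  ∃ P : PiLp 2 (fun _ : Fin d => E), P ≠ 0 ∧ HasAsymptoticVelocity H Q ψ P

end Abstract

section Multiplication

variable {X : Type*} [MeasurableSpace X] {μ : Measure X} {d : ℕ}

/-- Multiplication by the real function `V`, essentially bounded, on `L²(X)`. -/
def potential (V : X → ℝ) (hV : MemLp V ∞ μ) : Lp ℂ 2 μ →L[ℂ] Lp ℂ 2 μ :=
  (ContinuousLinearMap.mul ℂ ℂ).holderL μ ∞ 2 2 ((hV.ofReal (K := ℂ)).toLp (fun x => (V x : ℂ)))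

/-- The domain `{ψ | ψ, qⱼ ψ ∈ L²(X) for all j}`. -/
def multiplicationDomain (q : Fin d → X → ℝ) : Submodule ℂ (Lp ℂ 2 μ) where
  carrier := {ψ | ∀ j, MemLp (fun x => (q j x : ℂ) * ψ x) 2 μ}
  zero_mem' := by
    intro j
    refine (memLp_congr_ae ?_).mp (MemLp.zero (ε := ℂ))
    filter_upwards [Lp.coeFn_zero ℂ 2 μ] with x hx
    rw [hx]; simp
  add_mem' := by
    intro ψ φ hψ hφ j
    refine (memLp_congr_ae ?_).mp ((hψ j).add (hφ j))
    filter_upwards [Lp.coeFn_add ψ φ] with x hx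
    rw [hx]; simp [mul_add]
  smul_mem' := by
    intro c ψ hψ j
    refine (memLp_congr_ae ?_).mp ((hψ j).const_smul c)
    filter_upwards [Lp.coeFn_smul c ψ] with x hx
    rw [hx]; simp [mul_left_comm]

/-- The vector-valued multiplication operator `ψ ↦ (q₁ ψ, …, q_d ψ)` from `L²(X)` to `L²(X)ᵈ` on its
maximal domain. -/
def multiplication (q : Fin d → X → ℝ) :
    Lp ℂ 2 μ →ₗ.[ℂ] PiLp 2 (fun _ : Fin d => Lp ℂ 2 μ) where
  domain := multiplicationDomain q
  toFun :=
    { toFun := fun ψ => WithLp.toLp 2 fun j =>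
        MemLp.toLp (fun x => (q j x : ℂ) * (ψ : Lp ℂ 2 μ) x) (ψ.2 j)
      map_add' := by
        intro ψ φ
        refine congrArg (WithLp.toLp 2) (funext fun j => ?_)
        refine (MemLp.toLp_congr ((ψ + φ).2 j) ((ψ.2 j).add (φ.2 j)) ?_).trans
          (MemLp.toLp_add (ψ.2 j) (φ.2 j))
        filter_upwards [Lp.coeFn_add ψ.1 φ.1] with x hx
        rw [Submodule.coe_add, hx]; simp [mul_add]
      map_smul' := by
        intro c ψ
        refine congrArg (WithLp.toLp 2) (funext fun j => ?_)
        refine (MemLp.toLp_congr ((c • ψ).2 j) ((ψ.2 j).const_smul c) ?_).trans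
          (MemLp.toLp_const_smul c (ψ.2 j))
        filter_upwards [Lp.coeFn_smul c ψ.1] with x hx
        rw [Submodule.coe_smul, hx]; simp [mul_left_comm] }

end Multiplication

section Continuum

variable (d : ℕ)

/-- `L²(ℝᵈ)`. -/
abbrev L2Continuum : Type := Lp ℂ 2 (volume : Measure (EuclideanSpace ℝ (Fin d)))

/-- The position operator on `L²(ℝᵈ)`. -/
def positionContinuum : L2Continuum d →ₗ.[ℂ] PiLp 2 (fun _ : Fin d => L2Continuum d) :=
  multiplication fun j x => x j

variable {d}

/-- The embedding of `L²(ℝᵈ)` into the tempered distributions. -/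
abbrev toDistribution : L2Continuum d →L[ℂ] TemperedDistribution (EuclideanSpace ℝ (Fin d)) ℂ :=
  Lp.toTemperedDistributionCLM ℂ volume 2

theorem toDistribution_injective : Function.Injective (toDistribution (d := d)) :=
  LinearMap.ker_eq_bot.mp (Lp.ker_toTemperedDistributionCLM_eq_bot (F := ℂ) (p := 2)
    (μ := (volume : Measure (EuclideanSpace ℝ (Fin d)))))

variable (d) in
/-- The Sobolev space `H²(ℝᵈ)`. -/
def sobolevTwo : Submodule ℂ (L2Continuum d) where
  carrier := {ψ | TemperedDistribution.MemSobolev 2 2 (toDistribution ψ)}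
  zero_mem' := by
    simpa only [Set.mem_ofPred_eq, map_zero] using
      TemperedDistribution.memSobolev_fun_zero (EuclideanSpace ℝ (Fin d)) ℂ 2 2
  add_mem' := by
    intro ψ φ hψ hφ
    simpa only [Set.mem_ofPred_eq, map_add] using TemperedDistribution.MemSobolev.add hψ hφ
  smul_mem' := by
    intro c ψ hψ
    simpa only [Set.mem_ofPred_eq, map_smul] using TemperedDistribution.MemSobolev.smul c hψ

theorem exists_laplacian (ψ : sobolevTwo d) :
    ∃ η : L2Continuum d, toDistribution η = Δ (toDistribution (ψ : L2Continuum d)) := by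
  have h := TemperedDistribution.MemSobolev.laplacian ψ.2
  rw [sub_self] at h
  obtain ⟨η, hη⟩ := TemperedDistribution.memSobolev_zero_iff.mp h
  exact ⟨η, hη.symm⟩

/-- The element `Δ ψ` of `L²(ℝᵈ)` that represents the distributional Laplacian of `ψ ∈ H²(ℝᵈ)`. -/
def laplacianFun (ψ : sobolevTwo d) : L2Continuum d := (exists_laplacian ψ).choose

theorem toDistribution_laplacianFun (ψ : sobolevTwo d) :
    toDistribution (laplacianFun ψ) = Δ (toDistribution (ψ : L2Continuum d)) :=
  (exists_laplacian ψ).choose_spec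

variable (d) in
/-- The Laplacian on `L²(ℝᵈ)` with domain `H²(ℝᵈ)`. -/
def laplacianContinuum : L2Continuum d →ₗ.[ℂ] L2Continuum d where
  domain := sobolevTwo d
  toFun :=
    { toFun := laplacianFun
      map_add' := by
        intro ψ φ
        apply toDistribution_injective
        rw [map_add, toDistribution_laplacianFun, toDistribution_laplacianFun,
          toDistribution_laplacianFun, Submodule.coe_add, map_add,
          ← TemperedDistribution.laplacianCLM_apply, map_add,
          TemperedDistribution.laplacianCLM_apply, TemperedDistribution.laplacianCLM_apply]
      map_smul' := by
        intro c ψ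
        apply toDistribution_injective
        rw [RingHom.id_apply, map_smul, toDistribution_laplacianFun,
          toDistribution_laplacianFun, Submodule.coe_smul, map_smul,
          ← TemperedDistribution.laplacianCLM_apply, map_smul,
          TemperedDistribution.laplacianCLM_apply] }

/-- The Schrödinger operator `H = -Δ + V` on `L²(ℝᵈ)` with domain `H²(ℝᵈ)`. -/
def schrodingerContinuum (V : EuclideanSpace ℝ (Fin d) → ℝ) (hV : MemLp V ∞ volume) :
    L2Continuum d →ₗ.[ℂ] L2Continuum d where
  domain := (laplacianContinuum d).domain
  toFun := -(laplacianContinuum d).toFun + (potential V hV : L2Continuum d →ₗ[ℂ] L2Continuum d).domRestrict _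

end Continuum

section Lattice

variable (d : ℕ)

/-- `ℓ²(ℤᵈ)`, as the `L²` space of the counting measure. -/
abbrev L2Lattice : Type := Lp ℂ 2 (Measure.count : Measure (Fin d → ℤ))

/-- The position operator on `ℓ²(ℤᵈ)`. -/
def positionLattice : L2Lattice d →ₗ.[ℂ] PiLp 2 (fun _ : Fin d => L2Lattice d) :=
  multiplication fun j n => (n j : ℝ)

variable {d}

theorem measurePreserving_add_count (a : Fin d → ℤ) :
    MeasurePreserving (fun n : Fin d → ℤ => n + a) Measure.count Measure.count :=
  ⟨measurable_of_countable _, by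
    ext s hs
    rw [Measure.map_apply (measurable_of_countable _) hs,
      Measure.count_apply (measurable_of_countable (fun n : Fin d → ℤ => n + a) hs),
      Measure.count_apply hs]
    congr 1
    exact Set.encard_preimage_of_bijective (Equiv.addRight a).bijective s⟩

/-- The translation `(T_a ψ)(n) = ψ(n + a)` on `ℓ²(ℤᵈ)`. -/
def translation (a : Fin d → ℤ) : L2Lattice d →ₗ[ℂ] L2Lattice d :=
  Lp.compMeasurePreservingₗ ℂ (fun n : Fin d → ℤ => n + a) (measurePreserving_add_count a)

variable (d) in
/-- The lattice Laplacian `(Δ ψ)(n) = ∑ⱼ (ψ(n + eⱼ) + ψ(n - eⱼ) - 2 ψ(n))`. -/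
def laplacianLattice : L2Lattice d →ₗ[ℂ] L2Lattice d :=
  ∑ j : Fin d, (translation (Pi.single j 1) + translation (-Pi.single j 1)
    - (2 : ℂ) • LinearMap.id)

/-- The Schrödinger operator `H = -Δ + V` on all of `ℓ²(ℤᵈ)`. -/
def schrodingerLattice (V : (Fin d → ℤ) → ℝ) (hV : MemLp V ∞ Measure.count) :
    L2Lattice d →ₗ.[ℂ] L2Lattice d :=
  (-laplacianLattice d + (potential V hV : L2Lattice d →ₗ[ℂ] L2Lattice d)).toPMap ⊤

end Lattice

end BallisticTransport

end

/-! Asymptotic velocities add, so it suffices that `φ` has asymptotic velocity zero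
(`hasAsymptoticVelocity_zero`). Integrating the Heisenberg equation gives `Q(t) φ = Q φ + ∫₀ᵗ
e^{isH} w e^{-isH} φ ds` with the velocity `w = i[H, Q]`, which is `-2i∂ⱼ` on `ℝᵈ` and `-i` times
the difference of the two unit shifts on `ℤᵈ`. After division by `t` the term `Q φ` disappears, and
what remains is a time average of velocities.

If `H φ = l φ`, the integrand is `e^{-ils} e^{isH} w φ`. By the mean ergodic theorem
(`tendsto_average_zero`) its average tends to the projection of `w φ` to the eigenspace of `l`, and
this projection vanishes by the virial theorem (`inner_velocity_eq_zero`). Since `w` is bounded by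
the graph norm of `H`, which the evolution preserves, the result extends from eigenvectors to `ℋ_pp
∩ D(H)`, provided that finite combinations of eigenvectors are dense there in the graph norm. They
are: `H + i` maps their span onto itself, and `‖(H + i)ψ‖` controls the graph norm.

Eigenvectors need not lie in `D(Q)`, and it is not clear beforehand that `e^{-itH} φ` stays there.
Hence `q` is replaced by the bounded multipliers `(n+1)(e^{iq/(n+1)} - 1)/i`. Their commutators with
`H` are explicit, uniformly graph bounded and strongly convergent to `w` (`IsVelocityLimit`), and
`Q` on its maximal domain is exactly their strong limit (`IsStrongLimit`). Passing to the limit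
yields both the invariance of the domain and the integral formula. The existence of the dynamics
comes from `ψ`: the junk propagator `0` allows no nonzero velocity. -/

noncomputable section

namespace BallisticTransport

/-! ### Unitary groups and the mean ergodic theorem. -/

section UnitaryGroup

variable {E : Type*} [NormedAddCommGroup E] [InnerProductSpace ℂ E]
  {U : ℝ → E →L[ℂ] E}

namespace IsUnitaryGroup

theorem apply_apply (hU : IsUnitaryGroup U) (s t : ℝ) (ψ : E) : U s (U t ψ) = U (s + t) ψ := by
  rw [hU.add]; rfl

theorem zero_apply (hU : IsUnitaryGroup U) (ψ : E) : U 0 ψ = ψ := by rw [hU.zero]; rfl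

theorem neg_apply_apply (hU : IsUnitaryGroup U) (t : ℝ) (ψ : E) : U (-t) (U t ψ) = ψ := by
  rw [hU.apply_apply, neg_add_cancel, hU.zero_apply]

theorem apply_neg_apply (hU : IsUnitaryGroup U) (t : ℝ) (ψ : E) : U t (U (-t) ψ) = ψ := by
  rw [hU.apply_apply, add_neg_cancel, hU.zero_apply]

theorem comm (hU : IsUnitaryGroup U) (s t : ℝ) (ψ : E) : U s (U t ψ) = U t (U s ψ) := by
  rw [hU.apply_apply, hU.apply_apply, add_comm]

theorem inner_map_map (hU : IsUnitaryGroup U) (t : ℝ) (ψ η : E) :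
    inner ℂ (U t ψ) (U t η) = inner ℂ ψ η :=
  (LinearMap.norm_map_iff_inner_map_map (U t)).mp (hU.norm_map t) ψ η

theorem inner_map_left (hU : IsUnitaryGroup U) (t : ℝ) (ψ η : E) :
    inner ℂ (U t ψ) η = inner ℂ ψ (U (-t) η) := by
  rw [← hU.inner_map_map t ψ (U (-t) η), hU.apply_neg_apply]

/-- The time reversal of a unitary group. -/
theorem neg (hU : IsUnitaryGroup U) : IsUnitaryGroup fun t => U (-t) where
  zero := by rw [neg_zero, hU.zero]
  add s t := by rw [neg_add, hU.add]
  norm_map t := hU.norm_map (-t)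
  continuous ψ := (hU.continuous ψ).comp continuous_neg

/-- The multiple of a unitary group by the character `t ↦ e^{-ilt}`. -/
theorem exp_smul (hU : IsUnitaryGroup U) (l : ℝ) :
    IsUnitaryGroup fun t => Complex.exp (-Complex.I * l * t) • U t where
  zero := by simp [hU.zero]
  add s t := by
    ext ψ
    simp only [smul_apply, ContinuousLinearMap.comp_apply, map_smul, smul_smul,
      hU.apply_apply, ← Complex.exp_add]
    congr 2
    push_cast
    ring
  norm_map t ψ := by
    have h : -Complex.I * l * t = ((-(l * t) : ℝ) : ℂ) * Complex.I := by push_cast; ring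
    rw [smul_apply, norm_smul, hU.norm_map, h, Complex.norm_exp_ofReal_mul_I,
      one_mul]
  continuous ψ := by
    have := hU.continuous ψ
    simp only [smul_apply]
    fun_prop

/-- Joint continuity of a unitary group along a curve of vectors. -/
theorem tendsto_apply (hU : IsUnitaryGroup U) {α : Type*} {l : Filter α} {τ : α → ℝ} {t : ℝ}
    {g : α → E} {ψ : E} (hτ : Tendsto τ l (𝓝 t)) (hg : Tendsto g l (𝓝 ψ)) :
    Tendsto (fun a => U (τ a) (g a)) l (𝓝 (U t ψ)) := by
  have h1 : Tendsto (fun a => U (τ a) (g a - ψ)) l (𝓝 0) := by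
    rw [tendsto_zero_iff_norm_tendsto_zero]
    simp only [hU.norm_map]
    exact tendsto_iff_norm_sub_tendsto_zero.mp hg
  have h2 : Tendsto (fun a => U (τ a) ψ) l (𝓝 (U t ψ)) :=
    ((hU.continuous ψ).tendsto t).comp hτ
  simpa [map_sub] using h1.add h2

theorem continuous_apply (hU : IsUnitaryGroup U) {X : Type*} [TopologicalSpace X] {τ : X → ℝ}
    {g : X → E} (hτ : Continuous τ) (hg : Continuous g) : Continuous fun x => U (τ x) (g x) :=
  continuous_iff_continuousAt.mpr fun x => hU.tendsto_apply (hτ.tendsto x) (hg.tendsto x)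

/-- The product rule for `s ↦ U s (g s)`, when `g t` is a differentiable vector of `U`. -/
theorem hasDerivAt_apply (hU : IsUnitaryGroup U) {g : ℝ → E} {g' u' : E} {t : ℝ}
    (hg : HasDerivAt g g' t) (hu : HasDerivAt (fun s => U s (g t)) u' t) :
    HasDerivAt (fun s => U s (g s)) (u' + U t g') t := by
  have h : HasDerivAt (fun s => U s (g s - g t)) (U t g') t := by
    rw [hasDerivAt_iff_tendsto_slope] at hg ⊢
    have := hU.tendsto_apply (tendsto_id.mono_left (nhdsWithin_le_nhds (a := t) (s := {t}ᶜ))) hg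
    refine this.congr fun s => ?_
    simp [slope_def_module]
  convert hu.add h using 1
  ext s
  simp [map_sub]

/-- The continuous-time mean ergodic theorem, for vectors orthogonal to the fixed vectors. -/
theorem tendsto_average_zero [CompleteSpace E] (hU : IsUnitaryGroup U) {χ : E}
    (hχ : ∀ ξ : E, (∀ s, U s ξ = ξ) → inner ℂ ξ χ = 0) :
    Tendsto (fun t : ℝ => (t : ℂ)⁻¹ • ∫ s in (0 : ℝ)..t, U s χ) atTop (𝓝 0) := by
  have hint : ∀ (ζ : E) (a b : ℝ), IntervalIntegrable (fun s => U s ζ) volume a b :=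
    fun ζ a b => (hU.continuous ζ).intervalIntegrable a b
  -- The orthogonal complement of the coboundaries `U s ζ - ζ` consists of fixed vectors, so `χ`
  -- lies in the closure of their span. On the span the averages can be computed.
  let K : Submodule ℂ E := Submodule.span ℂ {ξ | ∃ s ζ, ξ = U s ζ - ζ}
  have hmem : χ ∈ K.topologicalClosure := by
    rw [← Submodule.orthogonal_orthogonal_eq_closure, Submodule.mem_orthogonal]
    intro ξ hξ
    apply hχ
    have h1 : ∀ s ζ, inner ℂ (U s ζ) ξ = inner ℂ ζ ξ := fun s ζ => by
      have := (Submodule.mem_orthogonal K ξ).mp hξ _ (Submodule.subset_span ⟨s, ζ, rfl⟩)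
      rwa [inner_sub_left, sub_eq_zero] at this
    intro s
    refine ext_inner_left ℂ fun ζ => ?_
    rw [← h1 (-s) ζ, hU.inner_map_left, neg_neg]
  have hK : ∀ ξ ∈ K, Tendsto (fun t : ℝ => (t : ℂ)⁻¹ • ∫ s in (0 : ℝ)..t, U s ξ)
      atTop (𝓝 0) := by
    intro ξ hξ
    induction hξ using Submodule.span_induction with
    | zero => simp
    | add a b _ _ ha hb =>
      refine (by simpa using ha.add hb : Tendsto _ _ (𝓝 (0 : E))).congr fun t => ?_
      rw [← smul_add, ← intervalIntegral.integral_add (hint _ _ _) (hint _ _ _)]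
      simp [map_add]
    | smul c a _ ha =>
      refine (by simpa using ha.const_smul c : Tendsto _ _ (𝓝 (0 : E))).congr fun t => ?_
      rw [smul_comm, ← intervalIntegral.integral_smul]
      simp [map_smul]
    | mem a ha =>
      obtain ⟨r, ζ, rfl⟩ := ha
      have hb : ∀ t : ℝ, ‖∫ s in (0 : ℝ)..t, U s (U r ζ - ζ)‖ ≤ 2 * (‖ζ‖ * |r|) := by
        intro t
        -- The integrals over `[r, t + r]` and `[0, t]` cancel up to two pieces of length `|r|`,
        -- which gives a bound independent of `t`.
        have e : ∫ s in (0 : ℝ)..t, U s (U r ζ - ζ)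
            = (∫ s in t..t + r, U s ζ) - ∫ s in (0 : ℝ)..r, U s ζ := by
          simp only [map_sub, hU.apply_apply]
          have hr : IntervalIntegrable (fun s => U (s + r) ζ) volume 0 t :=
            ((hU.continuous ζ).comp (continuous_add_const r)).intervalIntegrable _ _
          have h1 := intervalIntegral.integral_add_adjacent_intervals
            (hint ζ 0 t) (hint ζ t (t + r))
          have h2 := intervalIntegral.integral_add_adjacent_intervals
            (hint ζ 0 r) (hint ζ r (t + r))
          rw [intervalIntegral.integral_sub hr (hint _ _ _),
            intervalIntegral.integral_comp_add_right (fun s => U s ζ), zero_add,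
            sub_eq_sub_iff_add_eq_add, add_comm, h2, ← h1, add_comm]
        rw [e, two_mul]
        refine (norm_sub_le _ _).trans (add_le_add ?_ ?_)
        · simpa using intervalIntegral.norm_integral_le_of_norm_le_const (a := t) (b := t + r)
            (f := fun s => U s ζ) (C := ‖ζ‖) fun s _ => (hU.norm_map s ζ).le
        · simpa using intervalIntegral.norm_integral_le_of_norm_le_const (a := 0) (b := r)
            (f := fun s => U s ζ) (C := ‖ζ‖) fun s _ => (hU.norm_map s ζ).le
      refine squeeze_zero_norm (a := fun t : ℝ => |t|⁻¹ * (2 * (‖ζ‖ * |r|))) (fun t => ?_) ?_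
      · rw [norm_smul, norm_inv, Complex.norm_real, Real.norm_eq_abs]
        exact mul_le_mul_of_nonneg_left (hb t) (by positivity)
      · simpa using (tendsto_inv_atTop_zero.comp tendsto_abs_atTop_atTop).mul_const
          (2 * (‖ζ‖ * |r|))
  rw [Metric.tendsto_nhds]
  intro ε hε
  obtain ⟨ξ, hξ, hd⟩ := Metric.mem_closure_iff.mp
    (by simpa [← SetLike.mem_coe, Submodule.topologicalClosure_coe] using hmem :
      χ ∈ closure (K : Set E)) (ε / 2) (half_pos hε)
  filter_upwards [Metric.tendsto_nhds.mp (hK ξ hξ) (ε / 2) (half_pos hε), eventually_gt_atTop 0]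
    with t ht ht0
  have e : (t : ℂ)⁻¹ • ∫ s in (0 : ℝ)..t, U s χ
      = (t : ℂ)⁻¹ • (∫ s in (0 : ℝ)..t, U s (χ - ξ)) + (t : ℂ)⁻¹ • ∫ s in (0 : ℝ)..t, U s ξ := by
    rw [← smul_add, ← intervalIntegral.integral_add (hint _ _ _) (hint _ _ _)]
    simp [map_sub]
  rw [dist_zero_right] at ht ⊢
  rw [e]
  refine (norm_add_le _ _).trans_lt ?_
  -- Averaging is a contraction, so the error of approximating `χ` by `ξ` is uniform in `t`.
  have h1 : ‖(t : ℂ)⁻¹ • ∫ s in (0 : ℝ)..t, U s (χ - ξ)‖ ≤ ‖χ - ξ‖ := by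
    have := intervalIntegral.norm_integral_le_of_norm_le_const (a := 0) (b := t)
            (f := fun s => U s (χ - ξ)) (C := ‖χ - ξ‖) fun s _ => (hU.norm_map s _).le
    rw [norm_smul, norm_inv, Complex.norm_real, Real.norm_eq_abs, abs_of_pos ht0,
      inv_mul_le_iff₀ ht0, mul_comm]
    simpa [abs_of_pos ht0] using this
  rw [dist_eq_norm] at hd
  linarith

end IsUnitaryGroup

end UnitaryGroup

/-! ### Generators, the virial theorem and average velocities. -/

section Propagator

variable {E : Type*} [NormedAddCommGroup E] [InnerProductSpace ℂ E]
  {H : E →ₗ.[ℂ] E} {U : ℝ → E →L[ℂ] E}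

namespace IsPropagator

theorem hasDerivAt_zero (hU : IsPropagator H U) (ψ : H.domain) :
    HasDerivAt (fun s => U s ψ) (-Complex.I • H ψ) 0 :=
  (hU.generator ψ (H ψ)).mpr ⟨ψ.2, rfl⟩

theorem exists_map_apply (hU : IsPropagator H U) (t : ℝ) (ψ : H.domain) :
    ∃ h : U t ψ ∈ H.domain, H ⟨U t ψ, h⟩ = U t (H ψ) := by
  refine (hU.generator _ _).mp ?_
  have h := ((U t).restrictScalars ℝ).hasFDerivAt.comp_hasDerivAt (0 : ℝ) (hU.hasDerivAt_zero ψ)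
  convert h using 1
  · ext s
    exact hU.isUnitaryGroup.comm s t ψ
  · simp

/-- The action of the propagator on the domain of its generator. -/
def evolve (hU : IsPropagator H U) (t : ℝ) : H.domain →ₗ[ℂ] H.domain :=
  (U t : E →ₗ[ℂ] E).restrict fun ψ hψ => (hU.exists_map_apply t ⟨ψ, hψ⟩).1

@[simp]
theorem coe_evolve (hU : IsPropagator H U) (t : ℝ) (ψ : H.domain) :
    (hU.evolve t ψ : E) = U t ψ := rfl

@[simp]
theorem map_evolve (hU : IsPropagator H U) (t : ℝ) (ψ : H.domain) :
    H (hU.evolve t ψ) = U t (H ψ) := (hU.exists_map_apply t ψ).2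

theorem hasDerivAt (hU : IsPropagator H U) (t : ℝ) (ψ : H.domain) :
    HasDerivAt (fun s => U s ψ) (-Complex.I • U t (H ψ)) t := by
  have h := hU.hasDerivAt_zero (hU.evolve t ψ)
  rw [hU.map_evolve, ← sub_self t] at h
  refine (h.comp_sub_const t t).congr_of_eventuallyEq (.of_forall fun s => ?_)
  simp [hU.isUnitaryGroup.apply_apply]

theorem hasDerivAt_neg (hU : IsPropagator H U) (t : ℝ) (ψ : H.domain) :
    HasDerivAt (fun s => U (-s) ψ) (Complex.I • U (-t) (H ψ)) t := by
  exact ((hU.hasDerivAt (-t) ψ).scomp t (_root_.hasDerivAt_neg t)).congr_deriv (by simp)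

/-- The generator of a unitary group is symmetric. -/
theorem inner_map_left (hU : IsPropagator H U) (ψ η : H.domain) :
    inner ℂ (H ψ) (η : E) = inner ℂ (ψ : E) (H η) := by
  have h := (hU.hasDerivAt_zero ψ).inner ℂ (hU.hasDerivAt_zero η)
  -- Symmetry is the vanishing derivative at `0` of this constant inner product.
  have h' : (fun t => inner ℂ (U t ψ) (U t η)) = fun _ => inner ℂ (ψ : E) (η : E) :=
    funext fun t => hU.isUnitaryGroup.inner_map_map t _ _
  rw [h'] at h
  have e := h.unique (hasDerivAt_const _ _)
  simp only [hU.isUnitaryGroup.zero_apply, inner_smul_left, inner_smul_right, map_neg,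
    Complex.conj_I, neg_neg, neg_mul, neg_add_eq_zero] at e
  exact (mul_left_cancel₀ Complex.I_ne_zero e).symm

/-- The cross term vanishes because symmetry makes `⟨Hψ, ψ⟩` real. Thus `‖(H + i)ψ‖` is equivalent
to the graph norm. -/
theorem norm_sq_map_add_smul (hU : IsPropagator H U) (ψ : H.domain) :
    ‖H ψ + Complex.I • (ψ : E)‖ ^ 2 = ‖H ψ‖ ^ 2 + ‖(ψ : E)‖ ^ 2 := by
  have h : (inner ℂ (H ψ) (ψ : E)).im = 0 := by
    rw [← Complex.conj_eq_iff_im, inner_conj_symm, hU.inner_map_left]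
  rw [norm_add_sq (𝕜 := ℂ), inner_smul_right, norm_smul]
  simp [h]

theorem norm_le_norm_map_add_smul (hU : IsPropagator H U) (ψ : H.domain) :
    ‖(ψ : E)‖ ≤ ‖H ψ + Complex.I • (ψ : E)‖ := by
  refine le_of_sq_le_sq ?_ (norm_nonneg _)
  rw [hU.norm_sq_map_add_smul]
  nlinarith [sq_nonneg ‖H ψ‖]

theorem norm_map_le_norm_map_add_smul (hU : IsPropagator H U) (ψ : H.domain) :
    ‖H ψ‖ ≤ ‖H ψ + Complex.I • (ψ : E)‖ := by
  refine le_of_sq_le_sq ?_ (norm_nonneg _)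
  rw [hU.norm_sq_map_add_smul]
  nlinarith [sq_nonneg ‖(ψ : E)‖]

/-- Eigenvectors of the generator evolve by a phase. -/
theorem apply_of_eigenvector (hU : IsPropagator H U) {l : ℝ} {φ : H.domain}
    (hφ : H φ = (l : ℂ) • (φ : E)) (t : ℝ) :
    U t φ = Complex.exp (-Complex.I * l * t) • (φ : E) := by
  have hd : ∀ s, HasDerivAt (fun s : ℝ => Complex.exp (Complex.I * l * s) • U s φ) 0 s := by
    intro s
    have h1 : HasDerivAt (fun s : ℝ => Complex.exp (Complex.I * l * s))
        (Complex.exp (Complex.I * l * s) * (Complex.I * l)) s := by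
      have := ((Complex.ofRealCLM.hasDerivAt (x := s)).const_mul (Complex.I * l)).cexp
      simpa using this
    refine (h1.smul (hU.hasDerivAt s φ)).congr_deriv ?_
    rw [hφ, map_smul, smul_smul, smul_smul, ← add_smul]
    ring_nf
    simp
  have hc := is_const_of_deriv_eq_zero (fun s => (hd s).differentiableAt) (fun s => (hd s).deriv)
    t 0
  simp only [hU.isUnitaryGroup.zero_apply, Complex.ofReal_zero, mul_zero, Complex.exp_zero,
    one_smul] at hc
  have h : U t φ = Complex.exp (-Complex.I * l * t) •
      (Complex.exp (Complex.I * l * t) • U t φ) := by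
    rw [smul_smul, ← Complex.exp_add]
    simp
  rw [h, hc]

/-- Identifies the fixed vectors of the group twisted by a phase, including their membership in the
domain, which the ergodic theorem does not supply. -/
theorem eigenvector_of_apply (hU : IsPropagator H U) {l : ℝ} {φ : E}
    (hφ : ∀ t : ℝ, U t φ = Complex.exp (-Complex.I * l * t) • φ) :
    ∃ h : φ ∈ H.domain, H ⟨φ, h⟩ = (l : ℂ) • φ := by
  refine (hU.generator _ _).mp ?_
  simp only [hφ]
  refine ((((Complex.ofRealCLM.hasDerivAt (x := 0)).const_mul
    (-Complex.I * l)).cexp).smul_const φ).congr_deriv ?_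
  rw [smul_smul]
  simp

end IsPropagator

/-- `u` is bounded by the graph norm of `H`. -/
def IsGraphBounded (H : E →ₗ.[ℂ] E) (u : H.domain →ₗ[ℂ] E) (C : ℝ) : Prop :=
  ∀ φ, ‖u φ‖ ≤ C * (‖H φ‖ + ‖(φ : E)‖)

/-- Bounded operators `D n` that preserve the domain of `H`, whose commutators `v n = i [H, D n]`
are bounded by the graph norm of `H`, uniformly in `n`, and converge strongly to `w`. -/
structure IsVelocityLimit (H : E →ₗ.[ℂ] E) (D : ℕ → E →L[ℂ] E) (v : ℕ → H.domain →ₗ[ℂ] E)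
    (w : H.domain →ₗ[ℂ] E) : Prop where
  commutator : ∀ (n : ℕ) (φ : H.domain), ∃ h : D n φ ∈ H.domain,
    Complex.I • (H ⟨D n φ, h⟩ - D n (H φ)) = v n φ
  bound : ∃ C, ∀ n, IsGraphBounded H (v n) C
  tendsto : ∀ φ, Tendsto (fun n => v n φ) atTop (𝓝 (w φ))

variable {D : ℕ → E →L[ℂ] E} {v : ℕ → H.domain →ₗ[ℂ] E} {w u : H.domain →ₗ[ℂ] E} {C : ℝ}

theorem IsVelocityLimit.isGraphBounded (h : IsVelocityLimit H D v w) :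
    ∃ C, IsGraphBounded H w C := by
  obtain ⟨C, hC⟩ := h.bound
  exact ⟨C, fun φ => le_of_tendsto (h.tendsto φ).norm (.of_forall fun n => hC n φ)⟩

namespace IsPropagator

theorem continuous_evolve (hU : IsPropagator H U) (hu : IsGraphBounded H u C) (φ : H.domain) :
    Continuous fun s => U (-s) (u (hU.evolve s φ)) := by
  refine hU.isUnitaryGroup.continuous_apply continuous_neg
    (continuous_iff_continuousAt.mpr fun t => tendsto_iff_norm_sub_tendsto_zero.mpr ?_)
  refine squeeze_zero (fun s => norm_nonneg _)
    (g := fun s => C * (‖U s (H φ) - U t (H φ)‖ + ‖U s φ - U t φ‖)) (fun s => ?_) ?_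
  · rw [← map_sub]
    simpa [LinearPMap.map_sub] using hu (hU.evolve s φ - hU.evolve t φ)
  · simpa using (((tendsto_iff_norm_sub_tendsto_zero.mp
      ((hU.isUnitaryGroup.continuous (H φ)).tendsto t)).add (tendsto_iff_norm_sub_tendsto_zero.mp
      ((hU.isUnitaryGroup.continuous (φ : E)).tendsto t))).const_mul C)

/-- `H` commutes with the evolution, so the graph norm is conserved and the bound is uniform in `s`.
-/
theorem norm_evolve_le (hU : IsPropagator H U) (hu : IsGraphBounded H u C) (φ : H.domain) (s : ℝ) :
    ‖U (-s) (u (hU.evolve s φ))‖ ≤ C * (‖H φ‖ + ‖(φ : E)‖) := by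
  simpa [hU.isUnitaryGroup.norm_map] using hu (hU.evolve s φ)

/-- The time integral `∫₀ᵗ e^{isH} w e^{-isH} φ ds` of the velocity `w`. -/
def displacement (hU : IsPropagator H U) (w : H.domain →ₗ[ℂ] E) (φ : H.domain) (t : ℝ) : E :=
  ∫ s in (0 : ℝ)..t, U (-s) (w (hU.evolve s φ))

/-- The Heisenberg equation for the bounded `D n`, integrated. The product rule applies because `D
n` preserves the domain of `H`. -/
theorem displacement_commutator [CompleteSpace E] (hU : IsPropagator H U)
    (h : IsVelocityLimit H D v w) (n : ℕ)
    (φ : H.domain) (t : ℝ) :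
    hU.displacement (v n) φ t = U (-t) (D n (U t φ)) - D n φ := by
  obtain ⟨C, hC⟩ := h.bound
  have hd : ∀ s, HasDerivAt (fun s => U (-s) (D n (U s φ))) (U (-s) (v n (hU.evolve s φ))) s := by
    intro s
    obtain ⟨hm, hc⟩ := h.commutator n (hU.evolve s φ)
    have h1 := ((D n).restrictScalars ℝ).hasFDerivAt.comp_hasDerivAt s (hU.hasDerivAt s φ)
    refine (hU.isUnitaryGroup.neg.hasDerivAt_apply h1 (hU.hasDerivAt_neg s ⟨_, hm⟩)).congr_deriv ?_
    rw [← hc]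
    simp [sub_eq_add_neg]
  rw [displacement, intervalIntegral.integral_eq_sub_of_hasDerivAt (fun s _ => hd s)
    ((hU.continuous_evolve (hC n) φ).intervalIntegrable _ _)]
  simp [hU.isUnitaryGroup.zero_apply]

/-- Dominated convergence: the graph bound, uniform in `n` and conserved in time, gives a constant
majorant. -/
theorem tendsto_displacement (hU : IsPropagator H U) (h : IsVelocityLimit H D v w)
    (φ : H.domain) (t : ℝ) :
    Tendsto (fun n => hU.displacement (v n) φ t) atTop (𝓝 (hU.displacement w φ t)) := by
  obtain ⟨C, hC⟩ := h.bound
  refine intervalIntegral.tendsto_integral_filter_of_dominated_convergence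
    (fun _ => C * (‖H φ‖ + ‖(φ : E)‖)) (.of_forall fun n => ?_) (.of_forall fun n => ?_) ?_ ?_
  · exact (hU.continuous_evolve (hC n) φ).aestronglyMeasurable
  · exact .of_forall fun s _ => hU.norm_evolve_le (hC n) φ s
  · exact intervalIntegrable_const
  · exact .of_forall fun s _ => ((U (-s)).continuous.tendsto _).comp (h.tendsto _)

/-- The evolved vector has the limit of `D n` that the displacement predicts. -/
theorem tendsto_apply [CompleteSpace E] (hU : IsPropagator H U) (h : IsVelocityLimit H D v w)
    {φ : H.domain} {χ : E} (hφ : Tendsto (fun n => D n φ) atTop (𝓝 χ)) (t : ℝ) :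
    Tendsto (fun n => D n (U t φ)) atTop (𝓝 (U t (χ + hU.displacement w φ t))) := by
  have h1 := ((U t).continuous.tendsto _).comp (hφ.add (hU.tendsto_displacement h φ t))
  refine h1.congr fun n => ?_
  simp [hU.displacement_commutator h, hU.isUnitaryGroup.apply_neg_apply]

/-- The virial theorem. -/
theorem inner_velocity_eq_zero (hU : IsPropagator H U) (h : IsVelocityLimit H D v w) {l : ℝ}
    {η φ : H.domain} (hη : H η = (l : ℂ) • (η : E)) (hφ : H φ = (l : ℂ) • (φ : E)) :
    inner ℂ (η : E) (w φ) = 0 := by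
  refine tendsto_nhds_unique ((tendsto_const_nhds (x := (η : E))).inner (h.tendsto φ)) ?_
  -- Already for each bounded `D n` the matrix element of the commutator is `i(l - l)⟨η, D n φ⟩ =
  -- 0`; only then is `n` sent to infinity.
  refine tendsto_const_nhds.congr fun n => ?_
  obtain ⟨hm, hc⟩ := h.commutator n φ
  rw [← hc, inner_smul_right, inner_sub_right, ← hU.inner_map_left, hη, hφ, inner_smul_left,
    map_smul, inner_smul_right]
  simp

theorem norm_average_displacement_le (hU : IsPropagator H U) (hw : IsGraphBounded H w C)
    (φ : H.domain) {t : ℝ} (ht : 0 < t) :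
    ‖(t : ℂ)⁻¹ • hU.displacement w φ t‖ ≤ C * (‖H φ‖ + ‖(φ : E)‖) := by
  have := intervalIntegral.norm_integral_le_of_norm_le_const (a := 0) (b := t)
    (f := fun s => U (-s) (w (hU.evolve s φ))) fun s _ => hU.norm_evolve_le hw φ s
  rw [norm_smul, norm_inv, Complex.norm_real, Real.norm_eq_abs, abs_of_pos ht,
    inv_mul_le_iff₀ ht, mul_comm]
  rwa [sub_zero, abs_of_pos ht] at this

theorem displacement_add (hU : IsPropagator H U) (hw : IsGraphBounded H w C) (φ χ : H.domain)
    (t : ℝ) : hU.displacement w (φ + χ) t = hU.displacement w φ t + hU.displacement w χ t := by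
  simp only [displacement, map_add]
  exact intervalIntegral.integral_add ((hU.continuous_evolve hw φ).intervalIntegrable _ _)
    ((hU.continuous_evolve hw χ).intervalIntegrable _ _)

theorem displacement_smul (hU : IsPropagator H U) (w : H.domain →ₗ[ℂ] E) (c : ℂ) (φ : H.domain)
    (t : ℝ) : hU.displacement w (c • φ) t = c • hU.displacement w φ t := by
  simp only [displacement, map_smul]
  exact intervalIntegral.integral_smul _ _

/-- The average velocity of an eigenvector vanishes. -/
theorem tendsto_average_of_eigenvector [CompleteSpace E] (hU : IsPropagator H U)
    (h : IsVelocityLimit H D v w)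
    {l : ℝ} {φ : H.domain} (hφ : H φ = (l : ℂ) • (φ : E)) :
    Tendsto (fun t : ℝ => (t : ℂ)⁻¹ • hU.displacement w φ t) atTop (𝓝 0) := by
  -- Since `φ` evolves by the phase `e^{-ils}`, the integrand is the orbit of the fixed vector `w φ`
  -- under the twisted group `e^{-ils} U (-s)`, whose invariant vectors are the eigenvectors for
  -- `l`.
  refine (hU.isUnitaryGroup.neg.exp_smul l).tendsto_average_zero (χ := w φ) (fun ξ hξ => ?_)
    |>.congr fun t => ?_
  · obtain ⟨hm, he⟩ := hU.eigenvector_of_apply (l := l) (φ := ξ) fun s => by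
      have := congrArg (U s) (hξ s)
      rw [smul_apply, map_smul, hU.isUnitaryGroup.apply_neg_apply] at this
      exact this.symm
    exact hU.inner_velocity_eq_zero h (η := ⟨ξ, hm⟩) he hφ
  · congr 1
    refine intervalIntegral.integral_congr fun s _ => ?_
    have : hU.evolve s φ = Complex.exp (-Complex.I * l * s) • φ :=
      Subtype.ext (hU.apply_of_eigenvector hφ s)
    simp only [this, map_smul, smul_apply]

/-- The average velocity vanishes on the pure point subspace. -/
theorem tendsto_average_of_mem_purePointSubspace [CompleteSpace E] (hU : IsPropagator H U)
    (h : IsVelocityLimit H D v w) {φ : H.domain} (hφ : (φ : E) ∈ purePointSubspace H) :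
    Tendsto (fun t : ℝ => (t : ℂ)⁻¹ • hU.displacement w φ t) atTop (𝓝 0) := by
  obtain ⟨C, hC⟩ := h.isGraphBounded
  set S := Submodule.span ℂ {φ : E | ∃ (l : ℝ) (h : φ ∈ H.domain), H ⟨φ, h⟩ = (l : ℂ) • φ}
  -- `H + i` is onto the span: on an eigenvector it is multiplication by `l + i`, which is nonzero
  -- for real `l`.
  have hspan : ∀ χ ∈ S, ∃ ζ : H.domain, H ζ + Complex.I • (ζ : E) = χ ∧
      Tendsto (fun t : ℝ => (t : ℂ)⁻¹ • hU.displacement w ζ t) atTop (𝓝 0) := by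
    intro χ hχ
    induction hχ using Submodule.span_induction with
    | zero => exact ⟨0, by simp, by simp [displacement]⟩
    | add a b _ _ ha hb =>
      obtain ⟨x, hx, hx'⟩ := ha
      obtain ⟨y, hy, hy'⟩ := hb
      refine ⟨x + y, ?_, ?_⟩
      · rw [← hx, ← hy, H.map_add, Submodule.coe_add, smul_add]
        abel
      · simpa [hU.displacement_add hC] using hx'.add hy'
    | smul c a _ ha =>
      obtain ⟨x, hx, hx'⟩ := ha
      refine ⟨c • x, ?_, ?_⟩
      · rw [← hx, H.map_smul, Submodule.coe_smul, smul_add, smul_comm c]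
      · simpa [hU.displacement_smul, smul_comm _ c] using hx'.const_smul c
    | mem a ha =>
      obtain ⟨l, hm, he⟩ := ha
      have hl : (l : ℂ) + Complex.I ≠ 0 := fun h0 => by simpa using congrArg Complex.im h0
      refine ⟨((l : ℂ) + Complex.I)⁻¹ • ⟨a, hm⟩, ?_, ?_⟩
      · rw [H.map_smul, he, Submodule.coe_smul, smul_comm Complex.I, ← smul_add, ← add_smul,
          smul_smul, inv_mul_cancel₀ hl, one_smul]
      · simp only [hU.displacement_smul, smul_comm _ ((l : ℂ) + Complex.I)⁻¹]
        simpa using (hU.tendsto_average_of_eigenvector h (φ := ⟨a, hm⟩) he).const_smul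
          ((l : ℂ) + Complex.I)⁻¹
  have hinv : ∀ t, ∀ χ ∈ S.topologicalClosure, U t χ ∈ S.topologicalClosure := by
    intro t χ hχ
    refine Submodule.topologicalClosure_mono (s := S.map (U t : E →ₗ[ℂ] E)) ?_ ?_
    · rw [Submodule.map_span_le]
      rintro a ⟨l, hm, he⟩
      rw [ContinuousLinearMap.coe_coe, hU.apply_of_eigenvector (φ := ⟨a, hm⟩) he t]
      exact Submodule.smul_mem _ _ (Submodule.subset_span ⟨l, hm, he⟩)
    · exact Submodule.topologicalClosure_map (U t) S ⟨χ, hχ, rfl⟩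
  -- `H φ` is `i` times the limit of the difference quotients of `U s φ`, which stay in the closed
  -- invariant subspace.
  have hHφ : H φ ∈ S.topologicalClosure := by
    have hd := (hasDerivAt_iff_tendsto_slope.mp (hU.hasDerivAt_zero φ)).const_smul Complex.I
    rw [smul_smul] at hd
    simp only [mul_neg, Complex.I_mul_I, neg_neg, one_smul] at hd
    refine S.isClosed_topologicalClosure.mem_of_tendsto hd (.of_forall fun s => ?_)
    refine Submodule.smul_mem _ _ ?_
    rw [slope_def_module, ← Complex.coe_smul]
    exact Submodule.smul_mem _ _ (Submodule.sub_mem _ (hinv _ _ hφ) (hinv _ _ hφ))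
  have hmem : H φ + Complex.I • (φ : E) ∈ closure (S : Set E) := by
    rw [← Submodule.topologicalClosure_coe]
    exact Submodule.add_mem _ hHφ (Submodule.smul_mem _ _ hφ)
  rw [Metric.tendsto_nhds]
  intro ε hε
  -- Both `‖H(φ - ζ)‖` and `‖φ - ζ‖` are at most `‖(H + i)(φ - ζ)‖`, whence the factor `2 * |C|`;
  -- the `+ 1` keeps the denominator positive when `C = 0`.
  obtain ⟨χ, hχ, hd⟩ := Metric.mem_closure_iff.mp hmem (ε / (2 * (2 * |C| + 1))) (by positivity)
  obtain ⟨ζ, hζ, hζ'⟩ := hspan χ hχ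
  filter_upwards [Metric.tendsto_nhds.mp hζ' (ε / 2) (half_pos hε), eventually_gt_atTop 0]
    with t ht ht0
  have e : hU.displacement w φ t = hU.displacement w (φ - ζ) t + hU.displacement w ζ t := by
    rw [← hU.displacement_add hC, sub_add_cancel]
  have hd' : ‖H (φ - ζ) + Complex.I • ((φ - ζ : H.domain) : E)‖ < ε / (2 * (2 * |C| + 1)) := by
    rw [dist_eq_norm, ← hζ] at hd
    rwa [H.map_sub, Submodule.coe_sub, smul_sub, sub_add_sub_comm]
  have h1 := hU.norm_average_displacement_le hC (φ - ζ) ht0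
  have h2 := hU.norm_le_norm_map_add_smul (φ - ζ)
  have h3 := hU.norm_map_le_norm_map_add_smul (φ - ζ)
  rw [lt_div_iff₀ (by positivity)] at hd'
  rw [dist_zero_right] at ht ⊢
  rw [e, smul_add]
  refine (norm_add_le _ _).trans_lt ?_
  have h4 : C * (‖H (φ - ζ)‖ + ‖((φ - ζ : H.domain) : E)‖)
      ≤ |C| * (2 * ‖H (φ - ζ) + Complex.I • ((φ - ζ : H.domain) : E)‖) :=
    mul_le_mul (le_abs_self C) (by linarith) (by positivity) (abs_nonneg C)
  nlinarith [norm_nonneg (H (φ - ζ) + Complex.I • ((φ - ζ : H.domain) : E))]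

end IsPropagator

end Propagator

/-! ### Asymptotic velocities of abstract position operators. -/

section AsymptoticVelocity

variable {E : Type*} [NormedAddCommGroup E] [InnerProductSpace ℂ E] {d : ℕ}
  {H : E →ₗ.[ℂ] E} {Q : E →ₗ.[ℂ] PiLp 2 (fun _ : Fin d => E)}

theorem isPropagator_propagator (h : ∃ U, IsPropagator H U) : IsPropagator H (propagator H) := by
  rw [propagator, dif_pos h]
  exact h.choose_spec

/-- Ballistic transport presupposes that the dynamics exists. -/
theorem StrongBallisticTransport.isPropagator {ψ : E} (h : StrongBallisticTransport H Q ψ) :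
    IsPropagator H (propagator H) := by
  by_contra hn
  have h0 : propagator H = 0 := dif_neg fun hex => hn (isPropagator_propagator hex)
  obtain ⟨P, hP, hv⟩ := h
  -- With the junk propagator `Q(t)` is zero, so the distance to `P` is `‖P‖` itself, not less.
  obtain ⟨t, hd, ht⟩ := (hv ‖P‖ (norm_pos_iff.mpr hP)).exists
  have hz : heisenberg H Q t ⟨ψ, hd⟩ = 0 := by
    ext j : 1
    simp [heisenberg, h0]
  rw [hz, smul_zero, zero_sub, norm_neg] at ht
  exact lt_irrefl _ ht

/-- Asymptotic velocities add up. -/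
theorem HasAsymptoticVelocity.add {ψ φ : E} {P R : PiLp 2 (fun _ : Fin d => E)}
    (hψ : HasAsymptoticVelocity H Q ψ P) (hφ : HasAsymptoticVelocity H Q φ R) :
    HasAsymptoticVelocity H Q (ψ + φ) (P + R) := by
  intro ε hε
  filter_upwards [hψ (ε / 2) (half_pos hε), hφ (ε / 2) (half_pos hε)]
  rintro t ⟨h1, h1'⟩ ⟨h2, h2'⟩
  refine ⟨Submodule.add_mem _ h1 h2, ?_⟩
  have e : heisenberg H Q t ⟨ψ + φ, Submodule.add_mem _ h1 h2⟩
      = heisenberg H Q t ⟨ψ, h1⟩ + heisenberg H Q t ⟨φ, h2⟩ :=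
    (heisenberg H Q t).map_add ⟨ψ, h1⟩ ⟨φ, h2⟩
  rw [e, smul_add, add_sub_add_comm]
  exact (norm_add_le _ _).trans_lt (by linarith)

/-- `Q` is the strong limit of the bounded operators `D j n` on the vectors where it exists. -/
def IsStrongLimit (Q : E →ₗ.[ℂ] PiLp 2 (fun _ : Fin d => E)) (D : Fin d → ℕ → E →L[ℂ] E) : Prop :=
  ∀ (ψ : E) (η : PiLp 2 (fun _ : Fin d => E)),
    (∃ h : ψ ∈ Q.domain, Q ⟨ψ, h⟩ = η) ↔ ∀ j, Tendsto (fun n => D j n ψ) atTop (𝓝 (η j))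

variable {D : Fin d → ℕ → E →L[ℂ] E} {v : Fin d → ℕ → H.domain →ₗ[ℂ] E}
  {w : Fin d → H.domain →ₗ[ℂ] E}

/-- Vectors of the pure point subspace have asymptotic velocity zero. -/
theorem hasAsymptoticVelocity_zero [CompleteSpace E] (hU : IsPropagator H (propagator H))
    (hQ : IsStrongLimit Q D)
    (hv : ∀ j, IsVelocityLimit H (D j) (v j) (w j)) {φ : E} (hφ : φ ∈ purePointSubspace H)
    (hφQ : φ ∈ Q.domain) (hφH : φ ∈ H.domain) : HasAsymptoticVelocity H Q φ 0 := by
  set χ := Q ⟨φ, hφQ⟩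
  have hχ := (hQ φ χ).mp ⟨hφQ, rfl⟩
  let η : ℝ → PiLp 2 (fun _ : Fin d => E) := fun t =>
    WithLp.toLp 2 fun j => χ j + hU.displacement (w j) ⟨φ, hφH⟩ t
  have hη : ∀ t, ∃ h : φ ∈ (heisenberg H Q t).domain, heisenberg H Q t ⟨φ, h⟩ = η t := by
    intro t
    -- The converse half of `IsStrongLimit`: convergence of the cutoffs on the evolved vector puts
    -- it into the domain of `Q`.
    obtain ⟨h, he⟩ := (hQ (propagator H t φ)
      (WithLp.toLp 2 fun j => propagator H t (η t j))).mpr fun j =>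
        hU.tendsto_apply (hv j) (φ := ⟨φ, hφH⟩) (hχ j) t
    refine ⟨h, ?_⟩
    ext j : 1
    change propagator H (-t) (Q ⟨propagator H t φ, h⟩ j) = η t j
    rw [he]
    exact hU.isUnitaryGroup.neg_apply_apply t _
  have hlim : Tendsto (fun t : ℝ => (t : ℂ)⁻¹ • η t) atTop (𝓝 0) := by
    have hj : ∀ j, Tendsto (fun t : ℝ => ((t : ℂ)⁻¹ • η t) j) atTop (𝓝 0) := by
      intro j
      have h1 : Tendsto (fun t : ℝ => (t : ℂ)⁻¹ • χ j) atTop (𝓝 0) := by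
        have : Tendsto (fun t : ℝ => ((t⁻¹ : ℝ) : ℂ)) atTop (𝓝 ((0 : ℝ) : ℂ)) :=
          (Complex.continuous_ofReal.tendsto 0).comp tendsto_inv_atTop_zero
        simpa using this.smul_const (χ j)
      simpa [η, smul_add] using
        h1.add (hU.tendsto_average_of_mem_purePointSubspace (hv j) (φ := ⟨φ, hφH⟩) hφ)
    have := ((PiLp.continuous_toLp 2 (fun _ : Fin d => E)).tendsto 0).comp
      (tendsto_pi_nhds.mpr hj)
    exact this
  intro ε hε
  filter_upwards [Metric.tendsto_nhds.mp hlim ε hε] with t ht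
  obtain ⟨h, he⟩ := hη t
  refine ⟨h, ?_⟩
  rwa [he, ← dist_eq_norm]

/-- Adding a vector of the pure point subspace does not change the asymptotic velocity. -/
theorem StrongBallisticTransport.add_purePoint [CompleteSpace E] (hQ : IsStrongLimit Q D)
    (hv : ∀ j, IsVelocityLimit H (D j) (v j) (w j)) {ψ φ : E}
    (hψ : StrongBallisticTransport H Q ψ) (hφ : φ ∈ purePointSubspace H)
    (hφQ : φ ∈ Q.domain) (hφH : φ ∈ H.domain) :
    StrongBallisticTransport H Q (ψ + φ) ∧
      ∀ P, HasAsymptoticVelocity H Q ψ P → HasAsymptoticVelocity H Q (ψ + φ) P := by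
  have h0 := hasAsymptoticVelocity_zero hψ.isPropagator hQ hv hφ hφQ hφH
  have h : ∀ P, HasAsymptoticVelocity H Q ψ P → HasAsymptoticVelocity H Q (ψ + φ) P :=
    fun P hP => by simpa using hP.add h0
  obtain ⟨P, hP, hψP⟩ := hψ
  exact ⟨⟨P, hP, h P hψP⟩, h⟩

end AsymptoticVelocity

/-! ### Multiplication operators and bounded cutoffs of the position. -/

section MultiplicationOperators

variable {X : Type*} [MeasurableSpace X] {μ : Measure X} {d : ℕ}

/-- Dominated convergence in `L²`. -/
theorem tendsto_Lp_two_of_dominated {F : ℕ → Lp ℂ 2 μ} {G : Lp ℂ 2 μ} {b : X → ℂ}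
    (hb : MemLp b 2 μ) (hF : ∀ n, ∀ᵐ x ∂μ, ‖F n x‖ ≤ ‖b x‖)
    (hlim : ∀ᵐ x ∂μ, Tendsto (fun n => F n x) atTop (𝓝 (G x))) : Tendsto F atTop (𝓝 G) := by
  rw [Lp.tendsto_Lp_iff_tendsto_eLpNorm']
  have hG : ∀ᵐ x ∂μ, ‖G x‖ ≤ ‖b x‖ := by
    filter_upwards [hlim, ae_all_iff.mpr hF] with x h1 h2
    exact le_of_tendsto h1.norm (.of_forall h2)
  have hsq : Tendsto (fun n => ∫⁻ x, ‖(F n - G : X → ℂ) x‖ₑ ^ (2 : ℝ) ∂μ) atTop (𝓝 0) := by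
    have h := tendsto_lintegral_of_dominated_convergence' (μ := μ)
      (F := fun n x => ‖(F n - G : X → ℂ) x‖ₑ ^ (2 : ℝ)) (f := fun _ => 0)
      (fun x => ‖(2 * b x : ℂ)‖ₑ ^ (2 : ℝ)) ?_ ?_ ?_ ?_
    · simpa using h
    · exact fun n => (((Lp.aestronglyMeasurable (F n)).sub
        (Lp.aestronglyMeasurable G)).enorm).pow_const _
    · intro n
      filter_upwards [hF n, hG] with x h1 h2
      refine ENNReal.rpow_le_rpow ?_ (by norm_num)
      rw [enorm_le_iff_norm_le, norm_mul, Complex.norm_ofNat]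
      exact (norm_sub_le _ _).trans (by linarith)
    · have := (hb.const_mul (2 : ℂ)).eLpNorm_lt_top
      have h2 := (eLpNorm_lt_top_iff_lintegral_rpow_enorm_lt_top (by norm_num) (by norm_num)).mp this
      simpa using h2.ne
    · filter_upwards [hlim] with x hx
      have h0 : Tendsto (fun n => ‖(F n - G : X → ℂ) x‖ₑ) atTop (𝓝 0) := by
        have := (continuous_enorm.tendsto _).comp (tendsto_sub_nhds_zero_iff.mpr hx)
        simpa [Function.comp_def] using this
      simpa [Function.comp_def] using ((ENNReal.continuous_rpow_const (y := 2)).tendsto 0).comp h0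
  have h := ((ENNReal.continuous_rpow_const (y := 1 / 2)).tendsto 0).comp hsq
  rw [ENNReal.zero_rpow_of_pos (by norm_num)] at h
  refine h.congr fun n => ?_
  rw [eLpNorm_eq_lintegral_rpow_enorm_toReal (by norm_num) (by norm_num)]
  simp

/-- Multiplication by a bounded function on `L²`. -/
def mulOp (f : X → ℂ) (hf : MemLp f ∞ μ) : Lp ℂ 2 μ →L[ℂ] Lp ℂ 2 μ :=
  (ContinuousLinearMap.mul ℂ ℂ).holderL μ ∞ 2 2 (hf.toLp f)

theorem coeFn_mulOp (f : X → ℂ) (hf : MemLp f ∞ μ) (ψ : Lp ℂ 2 μ) :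
    mulOp f hf ψ =ᵐ[μ] fun x => f x * ψ x := by
  filter_upwards [(ContinuousLinearMap.mul ℂ ℂ).coeFn_holder (r := 2) (hf.toLp f) ψ, hf.coeFn_toLp]
    with x h1 h2
  rw [h2] at h1
  exact h1

theorem mulOp_comm (f g : X → ℂ) (hf : MemLp f ∞ μ) (hg : MemLp g ∞ μ) (ψ : Lp ℂ 2 μ) :
    mulOp f hf (mulOp g hg ψ) = mulOp g hg (mulOp f hf ψ) := by
  refine Lp.ext ?_
  filter_upwards [coeFn_mulOp f hf (mulOp g hg ψ), coeFn_mulOp g hg ψ,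
    coeFn_mulOp g hg (mulOp f hf ψ), coeFn_mulOp f hf ψ] with x h1 h2 h3 h4
  rw [h1, h2, h3, h4, mul_left_comm]

theorem norm_mulOp_le {f : X → ℂ} (hf : MemLp f ∞ μ) (h : ∀ x, ‖f x‖ ≤ 1) (ψ : Lp ℂ 2 μ) :
    ‖mulOp f hf ψ‖ ≤ ‖ψ‖ := by
  refine Lp.norm_le_norm_of_ae_le ?_
  filter_upwards [coeFn_mulOp f hf ψ] with x hx
  rw [hx, norm_mul]
  exact mul_le_of_le_one_left (norm_nonneg _) (h x)

/-- Bounded multipliers approximating the multipliers `q j` approximate `multiplication q`. -/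
theorem isStrongLimit_multiplication {q : Fin d → X → ℝ} {f : Fin d → ℕ → X → ℂ}
    (hf : ∀ j n, MemLp (f j n) ∞ μ) (hle : ∀ j n x, ‖f j n x‖ ≤ |q j x|)
    (hlim : ∀ j x, Tendsto (fun n => f j n x) atTop (𝓝 (q j x : ℂ))) :
    IsStrongLimit (multiplication (μ := μ) q) fun j n => mulOp (f j n) (hf j n) := by
  intro ψ η
  have hae : ∀ j, ∀ᵐ x ∂μ, ∀ n, mulOp (f j n) (hf j n) ψ x = f j n x * ψ x :=
    fun j => ae_all_iff.mpr fun n => coeFn_mulOp _ _ _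
  have hpt : ∀ j, ∀ᵐ x ∂μ,
      Tendsto (fun n => mulOp (f j n) (hf j n) ψ x) atTop (𝓝 ((q j x : ℂ) * ψ x)) := by
    intro j
    filter_upwards [hae j] with x hx
    simp only [hx]
    exact (hlim j x).mul_const _
  constructor
  · rintro ⟨h, rfl⟩ j
    refine tendsto_Lp_two_of_dominated (b := fun x => (q j x : ℂ) * ψ x) (h j) (fun n => ?_) ?_
    · filter_upwards [hae j] with x hx
      rw [hx, norm_mul, norm_mul, Complex.norm_real]
      exact mul_le_mul_of_nonneg_right (hle j n x) (norm_nonneg _)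
    · filter_upwards [hpt j, (h j).coeFn_toLp] with x h1 h2
      change Tendsto _ _ (𝓝 (((h j).toLp _ : Lp ℂ 2 μ) x))
      rwa [h2]
  · intro h
    have he : ∀ j, (fun x => (q j x : ℂ) * ψ x) =ᵐ[μ] η j := by
      intro j
      -- A subsequence of the `L²`-convergent sequence converges almost everywhere, which identifies
      -- the limit with the pointwise one, `q j * ψ`.
      obtain ⟨ns, hns, hns'⟩ := (tendstoInMeasure_of_tendsto_Lp (h j)).exists_seq_tendsto_ae
      filter_upwards [hpt j, hns'] with x h1 h2
      exact tendsto_nhds_unique (h1.comp hns.tendsto_atTop) h2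
    have hm : ψ ∈ (multiplication (μ := μ) q).domain := fun j =>
      (memLp_congr_ae (he j)).mpr (Lp.memLp (η j))
    refine ⟨hm, ?_⟩
    ext j : 1
    refine Lp.ext ?_
    filter_upwards [(hm j).coeFn_toLp, he j] with x h1 h2
    exact h1.trans h2

/-- The phase `e^{ir/(n+1)}`. -/
def phase (n : ℕ) (r : ℝ) : ℂ := Complex.exp (Complex.I * ((r / (n + 1) : ℝ) : ℂ))

/-- The bounded approximation `(n+1) (e^{ir/(n+1)} - 1) / i` of the real number `r`. -/
def cutoff (n : ℕ) (r : ℝ) : ℂ := -Complex.I * (n + 1) * (phase n r - 1)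

theorem norm_phase (n : ℕ) (r : ℝ) : ‖phase n r‖ = 1 := by
  rw [phase, Complex.norm_exp_I_mul_ofReal]

theorem phase_add (n : ℕ) (r s : ℝ) : phase n (r + s) = phase n r * phase n s := by
  rw [phase, phase, phase, ← Complex.exp_add, add_div]
  push_cast
  ring_nf

theorem norm_natCast_add_one (n : ℕ) : ‖(n + 1 : ℂ)‖ = n + 1 := by
  exact_mod_cast Complex.norm_natCast (n + 1)

/-- From `|e^{is} - 1| ≤ |s|`. This is the domination by `q` that makes the cutoffs converge on all
of the maximal domain. -/
theorem norm_cutoff_le (n : ℕ) (r : ℝ) : ‖cutoff n r‖ ≤ |r| := by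
  have h := Real.norm_exp_I_mul_ofReal_sub_one_le (x := r / (n + 1))
  have hn : (0 : ℝ) < n + 1 := by positivity
  rw [Real.norm_eq_abs, abs_div, abs_of_pos hn, le_div_iff₀ hn] at h
  rw [cutoff, norm_mul, norm_mul, norm_neg, Complex.norm_I, one_mul, norm_natCast_add_one, mul_comm]
  exact h

theorem norm_cutoff_le_const (n : ℕ) (r : ℝ) : ‖cutoff n r‖ ≤ (n + 1) * 2 := by
  rw [cutoff, norm_mul, norm_mul, norm_neg, Complex.norm_I, one_mul, norm_natCast_add_one]
  refine mul_le_mul_of_nonneg_left ((norm_sub_le _ _).trans ?_) (by positivity)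
  rw [norm_phase, norm_one]
  norm_num

theorem tendsto_phase (r : ℝ) : Tendsto (fun n => phase n r) atTop (𝓝 1) := by
  have h : Tendsto (fun n : ℕ => r / (n + 1)) atTop (𝓝 0) := by
    simpa [div_eq_mul_inv] using (tendsto_one_div_add_atTop_nhds_zero_nat (𝕜 := ℝ)).const_mul r
  have hc : Continuous fun s : ℝ => Complex.exp (Complex.I * (s : ℂ)) := by fun_prop
  simpa [Function.comp_def, phase] using (hc.tendsto 0).comp h

/-- Up to the factor `-i`, the cutoff is the difference quotient of `s ↦ e^{irs}` at `0` with step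
`1/(n+1)`. -/
theorem tendsto_cutoff (r : ℝ) : Tendsto (fun n => cutoff n r) atTop (𝓝 (r : ℂ)) := by
  have hd : HasDerivAt (fun s : ℝ => Complex.exp (Complex.I * r * s)) (Complex.I * r) 0 := by
    simpa using ((Complex.ofRealCLM.hasDerivAt (x := 0)).const_mul (Complex.I * r)).cexp
  have hs : Tendsto (fun n : ℕ => 1 / ((n : ℝ) + 1)) atTop (𝓝[≠] 0) :=
    tendsto_nhdsWithin_iff.mpr ⟨tendsto_one_div_add_atTop_nhds_zero_nat,
      .of_forall fun n => by simp only [Set.mem_compl_iff, Set.mem_singleton_iff]; positivity⟩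
  have h := ((hasDerivAt_iff_tendsto_slope.mp hd).comp hs).const_mul (-Complex.I)
  rw [← mul_assoc, neg_mul, Complex.I_mul_I, neg_neg, one_mul] at h
  refine h.congr fun n => ?_
  simp only [Function.comp_apply, slope_def_module, cutoff, phase, Complex.real_smul]
  push_cast
  simp only [mul_zero, Complex.exp_zero, sub_zero, one_div, inv_inv]
  rw [← mul_assoc]
  congr 3
  ring_nf

theorem continuous_phase (n : ℕ) : Continuous (phase n) := by
  unfold phase
  fun_prop

theorem memLp_phase {q : X → ℝ} (hq : Measurable q) (n : ℕ) :
    MemLp (fun x => phase n (q x)) ∞ μ :=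
  memLp_top_of_bound ((continuous_phase n).measurable.comp hq).aestronglyMeasurable 1
    (.of_forall fun _ => (norm_phase n _).le)

theorem memLp_cutoff {q : X → ℝ} (hq : Measurable q) (n : ℕ) :
    MemLp (fun x => cutoff n (q x)) ∞ μ := by
  refine memLp_top_of_bound (Measurable.aestronglyMeasurable ?_) ((n + 1) * 2)
    (.of_forall fun _ => norm_cutoff_le_const n _)
  exact (((continuous_phase n).measurable.comp hq).sub_const 1).const_mul _

/-- Multiplication by the phase `e^{iq/(n+1)}`. -/
def phaseOp (μ : Measure X) {q : X → ℝ} (hq : Measurable q) (n : ℕ) : Lp ℂ 2 μ →L[ℂ] Lp ℂ 2 μ :=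
  mulOp (fun x => phase n (q x)) (memLp_phase hq n)

/-- Multiplication by the bounded approximation `cutoff n ∘ q` of `q`. -/
def cutoffOp (μ : Measure X) {q : X → ℝ} (hq : Measurable q) (n : ℕ) : Lp ℂ 2 μ →L[ℂ] Lp ℂ 2 μ :=
  mulOp (fun x => cutoff n (q x)) (memLp_cutoff hq n)

theorem isStrongLimit_cutoffOp {q : Fin d → X → ℝ} (hq : ∀ j, Measurable (q j)) :
    IsStrongLimit (multiplication (μ := μ) q) fun j n => cutoffOp μ (hq j) n :=
  isStrongLimit_multiplication (fun j n => memLp_cutoff (hq j) n)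
    (fun _ n _ => norm_cutoff_le n _) fun _ _ => tendsto_cutoff _

variable {q : X → ℝ} (hq : Measurable q)

theorem norm_phaseOp_le (n : ℕ) (ψ : Lp ℂ 2 μ) : ‖phaseOp μ hq n ψ‖ ≤ ‖ψ‖ :=
  norm_mulOp_le _ (fun _ => (norm_phase n _).le) ψ

theorem cutoffOp_eq (n : ℕ) (ψ : Lp ℂ 2 μ) :
    cutoffOp μ hq n ψ = (-Complex.I * (n + 1)) • (phaseOp μ hq n ψ - ψ) := by
  refine Lp.ext ?_
  filter_upwards [coeFn_mulOp _ (memLp_cutoff hq n) ψ, coeFn_mulOp _ (memLp_phase hq n) ψ,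
    Lp.coeFn_smul (-Complex.I * (n + 1)) (phaseOp μ hq n ψ - ψ),
    Lp.coeFn_sub (phaseOp μ hq n ψ) ψ] with x h1 h2 h3 h4
  rw [h3, Pi.smul_apply, h4, Pi.sub_apply, cutoffOp, h1, phaseOp, h2, cutoff, smul_eq_mul]
  ring

theorem tendsto_phaseOp (ψ : Lp ℂ 2 μ) :
    Tendsto (fun n => phaseOp μ hq n ψ) atTop (𝓝 ψ) := by
  have h : ∀ᵐ x ∂μ, ∀ n, phaseOp μ hq n ψ x = phase n (q x) * ψ x :=
    ae_all_iff.mpr fun n => coeFn_mulOp _ _ _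
  refine tendsto_Lp_two_of_dominated (Lp.memLp ψ) (fun n => ?_) ?_
  · filter_upwards [h] with x hx
    rw [hx, norm_mul, norm_phase, one_mul]
  · filter_upwards [h] with x hx
    simpa [hx] using (tendsto_phase (q x)).mul_const (ψ x)

/-- Joint continuity of the phase operators at the identity. -/
theorem tendsto_phaseOp_apply {g : ℕ → Lp ℂ 2 μ} {ψ : Lp ℂ 2 μ} (hg : Tendsto g atTop (𝓝 ψ)) :
    Tendsto (fun n => phaseOp μ hq n (g n)) atTop (𝓝 ψ) := by
  have h : Tendsto (fun n => phaseOp μ hq n (g n - ψ)) atTop (𝓝 0) :=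
    squeeze_zero_norm (fun n => norm_phaseOp_le hq n _) (tendsto_iff_norm_sub_tendsto_zero.mp hg)
  simpa [map_sub] using h.add (tendsto_phaseOp hq ψ)

/-- The commutators with the cutoffs, from those with the phases. -/
theorem isVelocityLimit_cutoffOp {H : Lp ℂ 2 μ →ₗ.[ℂ] Lp ℂ 2 μ}
    {v : ℕ → H.domain →ₗ[ℂ] Lp ℂ 2 μ} {w : H.domain →ₗ[ℂ] Lp ℂ 2 μ}
    (hc : ∀ (n : ℕ) (φ : H.domain), ∃ h : phaseOp μ hq n φ ∈ H.domain,
      (n + 1 : ℂ) • (H ⟨_, h⟩ - phaseOp μ hq n (H φ)) = v n φ)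
    {C : ℝ} (hC : ∀ n, IsGraphBounded H (v n) C)
    (hlim : ∀ φ, Tendsto (fun n => v n φ) atTop (𝓝 (w φ))) :
    IsVelocityLimit H (cutoffOp μ hq) v w where
  commutator n φ := by
    obtain ⟨hm, he⟩ := hc n φ
    have hd : cutoffOp μ hq n φ ∈ H.domain := by
      rw [cutoffOp_eq]
      exact Submodule.smul_mem _ _ (Submodule.sub_mem _ hm φ.2)
    have hs : (⟨_, hd⟩ : H.domain)
        = (-Complex.I * (n + 1)) • (⟨_, hm⟩ - φ : H.domain) := by
      refine Subtype.ext ?_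
      rw [Submodule.coe_smul, Submodule.coe_sub]
      exact cutoffOp_eq hq n (φ : Lp ℂ 2 μ)
    refine ⟨hd, ?_⟩
    -- The identity in the cutoff drops out of the commutator, and `i · (-i(n+1)) = n+1` is the
    -- scaling in `hc`.
    rw [hs, H.map_smul, H.map_sub, cutoffOp_eq, ← smul_sub, smul_smul, ← he,
      sub_sub_sub_cancel_right, ← mul_assoc, mul_neg, Complex.I_mul_I, neg_neg, one_mul]
  bound := ⟨C, hC⟩
  tendsto := hlim

end MultiplicationOperators

/-! ### The velocity on the lattice. -/

section LatticeVelocity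

variable {d : ℕ}

theorem measurable_latticeCoordinate (j : Fin d) :
    Measurable fun n : Fin d → ℤ => (n j : ℝ) := measurable_of_countable _

/-- The phase operators on `ℓ²(ℤᵈ)` in the direction `j`. -/
abbrev phaseLattice (j : Fin d) (n : ℕ) : L2Lattice d →L[ℂ] L2Lattice d :=
  phaseOp Measure.count (measurable_latticeCoordinate j) n

theorem norm_translation (a : Fin d → ℤ) (ψ : L2Lattice d) : ‖translation a ψ‖ = ‖ψ‖ :=
  Lp.norm_compMeasurePreserving ψ (measurePreserving_add_count a)

theorem translation_apply (a : Fin d → ℤ) (ψ : L2Lattice d) (m : Fin d → ℤ) :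
    translation a ψ m = ψ (m + a) :=
  Measure.ae_count_iff.mp
    (Lp.coeFn_compMeasurePreserving ψ (measurePreserving_add_count a)) m

theorem phaseLattice_apply (j : Fin d) (n : ℕ) (ψ : L2Lattice d) (m : Fin d → ℤ) :
    phaseLattice j n ψ m = phase n (m j) * ψ m :=
  Measure.ae_count_iff.mp (coeFn_mulOp _ (memLp_phase (measurable_latticeCoordinate j) n) ψ) m

/-- The Weyl relation between translations and characters. -/
theorem translation_phaseLattice (a : Fin d → ℤ) (j : Fin d) (n : ℕ) (ψ : L2Lattice d) :
    translation a (phaseLattice j n ψ)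
      = phase n (a j) • phaseLattice j n (translation a ψ) := by
  refine Lp.ext ?_
  filter_upwards [Lp.coeFn_smul (phase n (a j)) (phaseLattice j n (translation a ψ))] with m hm
  rw [hm, Pi.smul_apply, translation_apply, phaseLattice_apply, phaseLattice_apply,
    translation_apply, Pi.add_apply, Int.cast_add, phase_add, smul_eq_mul]
  ring

theorem phase_zero (n : ℕ) : phase n 0 = 1 := by simp [phase]

/-- Shifts in directions other than `j` commute with the phase, so only the two shifts by `±eⱼ`
contribute a correction. -/
theorem laplacianLattice_phaseLattice (j : Fin d) (n : ℕ) (ψ : L2Lattice d) :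
    laplacianLattice d (phaseLattice j n ψ) = phaseLattice j n (laplacianLattice d ψ
      + ((phase n 1 - 1) • translation (Pi.single j 1) ψ
        + (phase n (-1) - 1) • translation (-Pi.single j 1) ψ)) := by
  have h : ∀ k : Fin d,
      translation (Pi.single k 1) (phaseLattice j n ψ)
        + translation (-Pi.single k 1) (phaseLattice j n ψ) - (2 : ℂ) • phaseLattice j n ψ
      = phaseLattice j n ((translation (Pi.single k 1) ψ + translation (-Pi.single k 1) ψ
        - (2 : ℂ) • ψ) + if k = j then (phase n 1 - 1) • translation (Pi.single j 1) ψ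
          + (phase n (-1) - 1) • translation (-Pi.single j 1) ψ else 0) := by
    intro k
    simp only [translation_phaseLattice, map_add, map_sub, map_smul]
    by_cases hk : k = j
    · subst hk
      simp only [Pi.single_eq_same, Pi.neg_apply, Int.cast_one, Int.cast_neg, if_true, map_add,
        map_smul]
      module
    · simp [hk, phase_zero]
  simp only [laplacianLattice, LinearMap.sum_apply, LinearMap.sub_apply, LinearMap.add_apply,
    LinearMap.smul_apply, LinearMap.id_apply, h]
  rw [← map_sum, Finset.sum_add_distrib]
  simp

/-- The velocity on `ℓ²(ℤᵈ)` in the direction `j`. -/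
def velocityLattice (j : Fin d) : L2Lattice d →ₗ[ℂ] L2Lattice d :=
  -Complex.I • (translation (Pi.single j 1) - translation (-Pi.single j 1))

/-- The commutators of the lattice Schrödinger operators with the phases, rescaled. -/
def phaseVelocityLattice (j : Fin d) (n : ℕ) : L2Lattice d →ₗ[ℂ] L2Lattice d :=
  -Complex.I • (phaseLattice j n : L2Lattice d →ₗ[ℂ] L2Lattice d) ∘ₗ
    (cutoff n 1 • translation (Pi.single j 1) + cutoff n (-1) • translation (-Pi.single j 1))

theorem isVelocityLimit_lattice (V : (Fin d → ℤ) → ℝ) (hV : MemLp V ∞ Measure.count) (j : Fin d) :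
    IsVelocityLimit (schrodingerLattice V hV)
      (cutoffOp Measure.count (measurable_latticeCoordinate j))
      (fun n => (phaseVelocityLattice j n).domRestrict _) ((velocityLattice j).domRestrict _) := by
  -- The bound `2` counts two isometric shifts with coefficients `cutoff n (±1)` of modulus at most
  -- `1`.
  refine isVelocityLimit_cutoffOp (C := 2) _ (fun n φ => ⟨trivial, ?_⟩) (fun n φ => ?_) fun φ => ?_
  · change (n + 1 : ℂ) • ((-laplacianLattice d (phaseLattice j n φ)
        + potential V hV (phaseLattice j n φ))
      - phaseLattice j n (-laplacianLattice d φ + potential V hV φ)) = phaseVelocityLattice j n φ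
    have hp : potential V hV (phaseLattice j n φ) = phaseLattice j n (potential V hV φ) :=
      mulOp_comm _ _ hV.ofReal _ _
    have hs : ∀ r : ℝ, -((n + 1 : ℂ) * (phase n r - 1)) = -Complex.I * cutoff n r := by
      intro r
      rw [cutoff, ← mul_assoc, ← mul_assoc, neg_mul_neg, Complex.I_mul_I]
      ring
    rw [hp, laplacianLattice_phaseLattice, phaseVelocityLattice]
    simp only [LinearMap.smul_apply, LinearMap.comp_apply, LinearMap.add_apply, map_add, map_neg,
      map_smul, ContinuousLinearMap.coe_coe, smul_add, smul_smul, ← hs]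
    module
  · have h1 := norm_cutoff_le n 1
    have h2 := norm_cutoff_le n (-1)
    rw [abs_one] at h1
    rw [abs_neg, abs_one] at h2
    have e : ‖phaseVelocityLattice j n φ‖ ≤ ‖(φ : L2Lattice d)‖ + ‖(φ : L2Lattice d)‖ := by
      rw [phaseVelocityLattice, LinearMap.smul_apply, norm_smul, norm_neg, Complex.norm_I, one_mul]
      refine (norm_phaseOp_le (measurable_latticeCoordinate j) n _).trans
        ((norm_add_le _ _).trans (add_le_add ?_ ?_))
      · rw [LinearMap.smul_apply, norm_smul, norm_translation]
        exact mul_le_of_le_one_left (norm_nonneg _) h1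
      · rw [LinearMap.smul_apply, norm_smul, norm_translation]
        exact mul_le_of_le_one_left (norm_nonneg _) h2
    rw [LinearMap.domRestrict_apply]
    linarith [norm_nonneg (schrodingerLattice V hV φ)]
  · have h1 := (tendsto_cutoff 1).smul_const (translation (Pi.single j 1) (φ : L2Lattice d))
    have h2 := (tendsto_cutoff (-1)).smul_const (translation (-Pi.single j 1) (φ : L2Lattice d))
    have h := (tendsto_phaseOp_apply (measurable_latticeCoordinate j) (h1.add h2)).const_smul
      (-Complex.I)
    have e : velocityLattice j φ = -Complex.I • (((1 : ℝ) : ℂ) • translation (Pi.single j 1)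
        (φ : L2Lattice d) + ((-1 : ℝ) : ℂ) • translation (-Pi.single j 1) (φ : L2Lattice d)) := by
      rw [velocityLattice, LinearMap.smul_apply, LinearMap.sub_apply]
      push_cast
      module
    change Tendsto (fun n => phaseVelocityLattice j n φ) atTop (𝓝 (velocityLattice j φ))
    rw [e]
    exact h

end LatticeVelocity

/-! ### Leibniz rules and the Bessel potential for tempered distributions. -/

section Distributions

open scoped SchwartzMap LineDeriv FourierTransform ContDiff

variable {E : Type*} [NormedAddCommGroup E] [InnerProductSpace ℝ E]

theorem hasDerivAt_phase (n : ℕ) (r : ℝ) :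
    HasDerivAt (phase n) (Complex.I / (n + 1) * phase n r) r := by
  have h := ((((hasDerivAt_id r).div_const ((n : ℝ) + 1)).ofReal_comp).const_mul Complex.I).cexp
  refine h.congr_deriv ?_
  rw [phase, id]
  push_cast
  ring

theorem hasTemperateGrowth_phase (n : ℕ) : (phase n).HasTemperateGrowth := by
  -- Every derivative is a constant multiple of a function of modulus one, hence bounded: growth
  -- exponent `0` suffices.
  have h : ∀ k, iteratedDeriv k (phase n) = fun r => (Complex.I / (n + 1)) ^ k * phase n r := by
    intro k
    induction k with
    | zero => simp
    | succ k ih =>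
      rw [iteratedDeriv_succ, ih]
      funext r
      rw [((hasDerivAt_phase n r).const_mul _).deriv, pow_succ]
      ring
  refine ⟨?_, fun k => ⟨0, ‖(Complex.I / (n + 1) : ℂ) ^ k‖, fun r => ?_⟩⟩
  · have : ContDiff ℝ ∞ fun r : ℝ => ((r / (n + 1) : ℝ) : ℂ) :=
      Complex.ofRealCLM.contDiff.comp (contDiff_id.div_const _)
    unfold phase
    fun_prop
  · rw [norm_iteratedFDeriv_eq_norm_iteratedDeriv, h, norm_mul, norm_phase]
    simp

/-- The Leibniz rule for a multiplier `e` with `∂ₘ e = c e`. -/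
theorem lineDerivOp_smulLeftCLM {e : E → ℂ} (he : e.HasTemperateGrowth) {m : E} {c : ℂ}
    (hd : ∀ x, fderiv ℝ e x m = c * e x) (u : 𝓢'(E, ℂ)) :
    ∂_{m} (TemperedDistribution.smulLeftCLM ℂ e u)
      = TemperedDistribution.smulLeftCLM ℂ e (∂_{m} u + c • u) := by
  -- The rule transposed to test functions, where the distributional derivative acts as `-∂ₘ`.
  have hs : ∀ g : 𝓢(E, ℂ), SchwartzMap.smulLeftCLM ℂ e (-∂_{m} g)
      = -∂_{m} (SchwartzMap.smulLeftCLM ℂ e g) + c • SchwartzMap.smulLeftCLM ℂ e g := by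
    intro g
    ext x
    have h1 : ∂_{m} (SchwartzMap.smulLeftCLM ℂ e g) x = c * e x * g x + e x * ∂_{m} g x := by
      rw [SchwartzMap.lineDerivOp_apply_eq_fderiv, SchwartzMap.smulLeftCLM_apply he]
      simp only [smul_eq_mul]
      rw [fderiv_fun_mul (he.1.differentiable (by simp) x) g.differentiableAt]
      simp [hd, SchwartzMap.lineDerivOp_apply_eq_fderiv]
      ring
    simp only [add_apply, neg_apply, smul_apply, h1,
      SchwartzMap.smulLeftCLM_apply_apply he, smul_eq_mul]
    ring
  ext g
  rw [TemperedDistribution.lineDerivOp_apply_apply, TemperedDistribution.smulLeftCLM_apply_apply,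
    hs, TemperedDistribution.smulLeftCLM_apply_apply, map_add, map_smul]
  rfl

variable [FiniteDimensional ℝ E]

/-- The Leibniz rule for the Laplacian and a multiplier `e` with `∂ᵢ e = cᵢ e`. -/
theorem laplacian_smulLeftCLM {ι : Type*} [Fintype ι] (b : OrthonormalBasis ι ℝ E) {e : E → ℂ}
    (he : e.HasTemperateGrowth) {c : ι → ℂ} (hd : ∀ i x, fderiv ℝ e x (b i) = c i * e x)
    (u : 𝓢'(E, ℂ)) :
    Δ (TemperedDistribution.smulLeftCLM ℂ e u) = TemperedDistribution.smulLeftCLM ℂ e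
      (Δ u + ∑ i, ((2 * c i) • ∂_{b i} u + c i ^ 2 • u)) := by
  rw [TemperedDistribution.laplacian_eq_sum b, TemperedDistribution.laplacian_eq_sum b,
    ← Finset.sum_add_distrib, map_sum]
  refine Finset.sum_congr rfl fun i _ => ?_
  rw [lineDerivOp_smulLeftCLM he (hd i), lineDerivOp_smulLeftCLM he (hd i)]
  congr 1
  rw [LineDeriv.lineDerivOp_add, LineDeriv.lineDerivOp_smul]
  module

variable [MeasurableSpace E] [BorelSpace E]

/-- The Bessel potential has symbol `1 + ‖x‖²`, and with the Fourier kernel `e^{-2πi⟨x,y⟩}` the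
Laplacian has symbol `-(2π)²‖x‖²`. -/
theorem besselPotential_two (u : 𝓢'(E, ℂ)) :
    TemperedDistribution.besselPotential E ℂ 2 u = u - ((2 * Real.pi : ℂ) ^ 2)⁻¹ • Δ u := by
  have h : (fun x : E => (((1 + ‖x‖ ^ 2) ^ ((2 : ℝ) / 2) : ℝ) : ℂ))
      = (fun _ => (1 : ℂ)) + fun x => ((‖x‖ ^ 2 : ℝ) : ℂ) := by
    ext x
    simp
  have hpi : (2 * Real.pi : ℂ) ^ 2 ≠ 0 := by
    simp [Real.pi_ne_zero]
  rw [TemperedDistribution.laplacian_eq_fourierMultiplierCLM, TemperedDistribution.besselPotential,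
    h, TemperedDistribution.fourierMultiplierCLM_apply,
    TemperedDistribution.smulLeftCLM_add (by fun_prop) (by fun_prop),
    add_apply, TemperedDistribution.smulLeftCLM_const, one_smul,
    FourierTransform.fourierInv_add, FourierTransform.fourierInv_fourier_eq,
    ← TemperedDistribution.fourierMultiplierCLM_apply, neg_smul, smul_neg, sub_neg_eq_add,
    ← Complex.coe_smul, smul_smul]
  push_cast
  rw [inv_mul_cancel₀ hpi, one_smul]

end Distributions

/-! ### The velocity on Euclidean space. -/

section ContinuumVelocity

open scoped SchwartzMap LineDeriv FourierTransform

variable {d : ℕ}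

theorem toDistribution_mulOp {e : EuclideanSpace ℝ (Fin d) → ℂ} (he : e.HasTemperateGrowth)
    (hb : MemLp e ∞ volume) (ψ : L2Continuum d) :
    toDistribution (mulOp e hb ψ) = TemperedDistribution.smulLeftCLM ℂ e (toDistribution ψ) := by
  rw [Lp.toTemperedDistributionCLM_apply, Lp.toTemperedDistributionCLM_apply,
    ← Lp.toTemperedDistribution_smul_eq (p := ∞) (r := 2) he hb]
  congr 1

/-- Elliptic regularity in its simplest form: for `ψ` in `L²`, the second Bessel potential is square
integrable as soon as `Δψ` is. This shows that the phases preserve `H²`. -/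
theorem mem_sobolevTwo_iff {ψ : L2Continuum d} :
    ψ ∈ sobolevTwo d ↔ ∃ η, toDistribution η = Δ (toDistribution ψ) := by
  refine ⟨fun h => exists_laplacian ⟨ψ, h⟩, fun ⟨η, hη⟩ => ?_⟩
  refine ⟨ψ - ((2 * Real.pi : ℂ) ^ 2)⁻¹ • η, ?_⟩
  rw [besselPotential_two, ← hη, ← map_smul, ← map_sub, Lp.toTemperedDistributionCLM_apply]

theorem toDistribution_laplacianContinuum (ψ : (laplacianContinuum d).domain) :
    toDistribution (laplacianContinuum d ψ) = Δ (toDistribution (ψ : L2Continuum d)) :=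
  toDistribution_laplacianFun ψ

/-- The symbol of `(2πi)⁻¹ ∂ₘ (1 - (2π)⁻² Δ)⁻¹`. -/
def derivSymbol (m x : EuclideanSpace ℝ (Fin d)) : ℂ :=
  ((inner ℝ x m : ℝ) : ℂ) * (((1 + ‖x‖ ^ 2) ^ ((-2 : ℝ) / 2) : ℝ) : ℂ)

theorem hasTemperateGrowth_derivSymbol (m : EuclideanSpace ℝ (Fin d)) :
    (derivSymbol m).HasTemperateGrowth := by
  unfold derivSymbol
  fun_prop

theorem memLp_derivSymbol (m : EuclideanSpace ℝ (Fin d)) : MemLp (derivSymbol m) ∞ volume := by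
  refine memLp_top_of_bound (hasTemperateGrowth_derivSymbol m).1.continuous.aestronglyMeasurable
    ‖m‖ (.of_forall fun x => ?_)
  have hx : (0 : ℝ) < 1 + ‖x‖ ^ 2 := by positivity
  rw [derivSymbol, norm_mul, Complex.norm_real, Complex.norm_real, neg_div, div_self two_ne_zero,
    Real.rpow_neg_one, norm_inv, Real.norm_of_nonneg hx.le, mul_inv_le_iff₀ hx]
  refine (norm_inner_le_norm x m).trans ?_
  nlinarith [norm_nonneg m, sq_nonneg (‖x‖ - 1), sq_nonneg ‖x‖]

/-- The bounded operator `∂ₘ (1 - (2π)⁻² Δ)⁻¹` on `L²(ℝᵈ)`. -/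
def derivResolvent (m : EuclideanSpace ℝ (Fin d)) : L2Continuum d →L[ℂ] L2Continuum d :=
  (2 * Real.pi * Complex.I) •
    ((Lp.fourierTransformₗᵢ (EuclideanSpace ℝ (Fin d)) ℂ).symm.toContinuousLinearEquiv :
      L2Continuum d →L[ℂ] L2Continuum d) ∘L mulOp (derivSymbol m) (memLp_derivSymbol m) ∘L
    ((Lp.fourierTransformₗᵢ (EuclideanSpace ℝ (Fin d)) ℂ).toContinuousLinearEquiv :
      L2Continuum d →L[ℂ] L2Continuum d)

/-- Fourier multipliers compose by multiplying symbols; the factor `2πi` belongs to the symbol of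
`∂ₘ`. -/
theorem toDistribution_derivResolvent (m : EuclideanSpace ℝ (Fin d)) (ψ : L2Continuum d) :
    toDistribution (derivResolvent m ψ) = ∂_{m}
      (TemperedDistribution.besselPotential (EuclideanSpace ℝ (Fin d)) ℂ (-2)
        (toDistribution ψ)) := by
  have h : derivResolvent m ψ = (2 * Real.pi * Complex.I) •
      𝓕⁻ (mulOp (derivSymbol m) (memLp_derivSymbol m) (𝓕 ψ)) := rfl
  rw [h, map_smul, Lp.toTemperedDistributionCLM_apply,
    ← Lp.fourierInv_toTemperedDistribution_eq, ← Lp.toTemperedDistributionCLM_apply,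
    toDistribution_mulOp (hasTemperateGrowth_derivSymbol m), Lp.toTemperedDistributionCLM_apply,
    ← Lp.fourier_toTemperedDistribution_eq, ← TemperedDistribution.fourierMultiplierCLM_apply,
    TemperedDistribution.lineDeriv_eq_fourierMultiplierCLM, TemperedDistribution.besselPotential,
    TemperedDistribution.fourierMultiplierCLM_fourierMultiplierCLM_apply (by fun_prop)
      (by fun_prop)]
  congr 3
  ext x
  simp only [derivSymbol, Pi.mul_apply]
  rw [mul_comm]

/-- The partial derivative `∂ₘ : H²(ℝᵈ) → L²(ℝᵈ)`. -/
def lineDerivContinuum (m : EuclideanSpace ℝ (Fin d)) :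
    (laplacianContinuum d).domain →ₗ[ℂ] L2Continuum d :=
  (derivResolvent m : L2Continuum d →ₗ[ℂ] L2Continuum d) ∘ₗ
    ((laplacianContinuum d).domain.subtype
      - ((2 * Real.pi : ℂ) ^ 2)⁻¹ • (laplacianContinuum d).toFun)

theorem lineDerivContinuum_apply (m : EuclideanSpace ℝ (Fin d))
    (ψ : (laplacianContinuum d).domain) :
    lineDerivContinuum m ψ = derivResolvent m
      ((ψ : L2Continuum d) - ((2 * Real.pi : ℂ) ^ 2)⁻¹ • laplacianContinuum d ψ) := rfl

/-- The Bessel potentials of orders `2` and `-2` cancel, leaving `∂ₘ`. Factoring through them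
exhibits the derivative as a bounded operator applied to a combination of `ψ` and `Δψ`. -/
theorem toDistribution_lineDerivContinuum (m : EuclideanSpace ℝ (Fin d))
    (ψ : (laplacianContinuum d).domain) :
    toDistribution (lineDerivContinuum m ψ) = ∂_{m} (toDistribution (ψ : L2Continuum d)) := by
  rw [lineDerivContinuum_apply, toDistribution_derivResolvent, map_sub, map_smul,
    toDistribution_laplacianContinuum, ← besselPotential_two,
    TemperedDistribution.besselPotential_besselPotential_apply]
  simp

theorem measurable_continuumCoordinate (j : Fin d) :
    Measurable fun x : EuclideanSpace ℝ (Fin d) => x j := by fun_prop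

/-- The phase operators on `L²(ℝᵈ)` in the direction `j`. -/
abbrev phaseContinuum (j : Fin d) (n : ℕ) : L2Continuum d →L[ℂ] L2Continuum d :=
  phaseOp volume (measurable_continuumCoordinate j) n

/-- The `j`-th partial derivative `H²(ℝᵈ) → L²(ℝᵈ)`. -/
abbrev partialContinuum (j : Fin d) : (laplacianContinuum d).domain →ₗ[ℂ] L2Continuum d :=
  lineDerivContinuum (EuclideanSpace.basisFun (Fin d) ℝ j)

theorem hasTemperateGrowth_phase_coordinate (j : Fin d) (n : ℕ) :
    (fun x : EuclideanSpace ℝ (Fin d) => phase n (x j)).HasTemperateGrowth :=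
  (hasTemperateGrowth_phase n).comp
    (EuclideanSpace.proj j : EuclideanSpace ℝ (Fin d) →L[ℝ] ℝ).hasTemperateGrowth

theorem fderiv_phase_coordinate (j i : Fin d) (n : ℕ) (x : EuclideanSpace ℝ (Fin d)) :
    fderiv ℝ (fun x : EuclideanSpace ℝ (Fin d) => phase n (x j)) x
        (EuclideanSpace.basisFun (Fin d) ℝ i)
      = (if i = j then Complex.I / (n + 1) else 0) * phase n (x j) := by
  have h := HasFDerivAt.comp (g := phase n) (f := fun x => x j) x
    (hasDerivAt_phase n (x j)).hasFDerivAt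
    (EuclideanSpace.proj j : EuclideanSpace ℝ (Fin d) →L[ℝ] ℝ).hasFDerivAt
  have h' : fderiv ℝ (fun x : EuclideanSpace ℝ (Fin d) => phase n (x j)) x = _ := h.fderiv
  rw [h']
  by_cases hij : i = j
  · subst hij
    simp
  · simp [hij, Ne.symm hij]

/-- The Laplacian of `e^{iεxⱼ} ψ`, with `ε = 1/(n+1)`. -/
theorem exists_laplacianContinuum_phase (j : Fin d) (n : ℕ) (ψ : (laplacianContinuum d).domain) :
    ∃ h : phaseContinuum j n ψ ∈ (laplacianContinuum d).domain,
      laplacianContinuum d ⟨_, h⟩ = phaseContinuum j n (laplacianContinuum d ψ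
        + ((2 * (Complex.I / (n + 1))) • partialContinuum j ψ
          + (Complex.I / (n + 1)) ^ 2 • (ψ : L2Continuum d))) := by
  have he := hasTemperateGrowth_phase_coordinate j n
  have hM : ∀ η : L2Continuum d, toDistribution (phaseContinuum j n η)
      = TemperedDistribution.smulLeftCLM ℂ (fun x => phase n (x j)) (toDistribution η) :=
    fun η => toDistribution_mulOp he _ η
  have key : toDistribution (phaseContinuum j n (laplacianContinuum d ψ
        + ((2 * (Complex.I / (n + 1))) • partialContinuum j ψ
          + (Complex.I / (n + 1)) ^ 2 • (ψ : L2Continuum d))))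
      = Δ (toDistribution (phaseContinuum j n ψ)) := by
    rw [hM, hM, laplacian_smulLeftCLM (EuclideanSpace.basisFun (Fin d) ℝ) he
      (fun i x => fderiv_phase_coordinate j i n x)]
    congr 1
    rw [map_add, map_add, map_smul, map_smul, toDistribution_laplacianContinuum,
      toDistribution_lineDerivContinuum, Finset.sum_eq_single j]
    · simp
    · intro i _ hij
      rw [if_neg hij, mul_zero, zero_pow two_ne_zero]
      module
    · simp
  refine ⟨mem_sobolevTwo_iff.mpr ⟨_, key⟩, toDistribution_injective ?_⟩
  rw [toDistribution_laplacianContinuum, key]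

theorem schrodingerContinuum_apply (V : EuclideanSpace ℝ (Fin d) → ℝ) (hV : MemLp V ∞ volume)
    (ψ : (laplacianContinuum d).domain) :
    schrodingerContinuum V hV ψ = -laplacianContinuum d ψ + potential V hV ψ := rfl

/-- The velocity on `L²(ℝᵈ)` in the direction `j`. -/
def velocityContinuum (j : Fin d) : (laplacianContinuum d).domain →ₗ[ℂ] L2Continuum d :=
  (-2 * Complex.I) • partialContinuum j

/-- The commutators of the Schrödinger operators on `ℝᵈ` with the phases, rescaled. -/
def phaseVelocityContinuum (j : Fin d) (n : ℕ) :
    (laplacianContinuum d).domain →ₗ[ℂ] L2Continuum d :=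
  (phaseContinuum j n : L2Continuum d →ₗ[ℂ] L2Continuum d) ∘ₗ
    (velocityContinuum j + ((n + 1 : ℂ)⁻¹) • (laplacianContinuum d).domain.subtype)

theorem norm_partialContinuum_le (V : EuclideanSpace ℝ (Fin d) → ℝ) (hV : MemLp V ∞ volume)
    (j : Fin d) : ∃ C, 0 ≤ C ∧ ∀ ψ : (laplacianContinuum d).domain,
      ‖partialContinuum j ψ‖ ≤ C * (‖schrodingerContinuum V hV ψ‖ + ‖(ψ : L2Continuum d)‖) := by
  set R := derivResolvent (EuclideanSpace.basisFun (Fin d) ℝ j)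
  set k : ℂ := ((2 * Real.pi : ℂ) ^ 2)⁻¹
  refine ⟨‖R‖ * (1 + ‖k‖ * (1 + ‖potential V hV‖)), by positivity, fun ψ => ?_⟩
  -- Since `V` is bounded, the graph norm of `H` controls `Δψ = Vψ - Hψ`.
  have h1 : ‖laplacianContinuum d ψ‖
      ≤ ‖schrodingerContinuum V hV ψ‖ + ‖potential V hV‖ * ‖(ψ : L2Continuum d)‖ := by
    have e : laplacianContinuum d ψ = potential V hV ψ - schrodingerContinuum V hV ψ := by
      rw [schrodingerContinuum_apply]
      abel
    rw [e, add_comm]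
    exact (norm_sub_le _ _).trans (add_le_add_left ((potential V hV).le_opNorm _) _)
  rw [lineDerivContinuum_apply, mul_assoc]
  refine (R.le_opNorm _).trans (mul_le_mul_of_nonneg_left ?_ (norm_nonneg R))
  refine (norm_sub_le _ _).trans ?_
  rw [norm_smul]
  have h2 := mul_le_mul_of_nonneg_left h1 (norm_nonneg k)
  have h3 := norm_nonneg (schrodingerContinuum V hV ψ)
  have h4 : 0 ≤ ‖k‖ * ‖potential V hV‖ * ‖schrodingerContinuum V hV ψ‖ := by positivity
  have h5 : 0 ≤ ‖k‖ * ‖(ψ : L2Continuum d)‖ := by positivity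
  nlinarith

theorem isVelocityLimit_continuum (V : EuclideanSpace ℝ (Fin d) → ℝ) (hV : MemLp V ∞ volume)
    (j : Fin d) :
    IsVelocityLimit (schrodingerContinuum V hV)
      (cutoffOp volume (measurable_continuumCoordinate j))
      (phaseVelocityContinuum j) (velocityContinuum j) := by
  obtain ⟨C, hC0, hC⟩ := norm_partialContinuum_le V hV j
  -- `2 * C` bounds the velocity `-2i∂ⱼ`, and `1` bounds the remainder `(n+1)⁻¹ φ` from the second
  -- derivative of the phase.
  refine isVelocityLimit_cutoffOp (C := 2 * C + 1) _ (fun n φ => ?_) (fun n φ => ?_) fun φ => ?_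
  · obtain ⟨hm, he⟩ := exists_laplacianContinuum_phase j n φ
    refine ⟨hm, ?_⟩
    have hp : potential V hV (phaseContinuum j n φ) = phaseContinuum j n (potential V hV φ) :=
      mulOp_comm _ _ hV.ofReal _ _
    have hn : (n + 1 : ℂ) ≠ 0 := Nat.cast_add_one_ne_zero n
    -- After rescaling by `n + 1` the first-order term is independent of `n` and gives the velocity,
    -- while the second-order term decays.
    have e1 : (n + 1 : ℂ) * (2 * (Complex.I / (n + 1))) = 2 * Complex.I := by
      field_simp
    have e2 : (n + 1 : ℂ) * (Complex.I / (n + 1)) ^ 2 = -(n + 1 : ℂ)⁻¹ := by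
      rw [div_pow, Complex.I_sq]
      field_simp
    change (n + 1 : ℂ) • ((-laplacianContinuum d ⟨_, hm⟩ + potential V hV (phaseContinuum j n φ))
      - phaseContinuum j n (-laplacianContinuum d φ + potential V hV φ))
      = phaseContinuum j n ((-2 * Complex.I) • partialContinuum j φ
        + ((n + 1 : ℂ)⁻¹) • (φ : L2Continuum d))
    rw [he, hp, ← map_neg, ← map_add, ← map_sub, ← map_smul]
    congr 1
    have e : ∀ a b c p : L2Continuum d, (n + 1 : ℂ) • (-(a + ((2 * (Complex.I / (n + 1))) • b
        + (Complex.I / (n + 1)) ^ 2 • c)) + p - (-a + p))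
        = -(((n + 1 : ℂ) * (2 * (Complex.I / (n + 1)))) • b)
          - ((n + 1 : ℂ) * (Complex.I / (n + 1)) ^ 2) • c := by
      intro a b c p
      module
    rw [e, e1, e2]
    module
  · refine (norm_phaseOp_le (measurable_continuumCoordinate j) n _).trans
      ((norm_add_le _ _).trans ?_)
    have hn : ‖((n + 1 : ℂ)⁻¹)‖ ≤ 1 := by
      rw [norm_inv, norm_natCast_add_one]
      exact inv_le_one_of_one_le₀ (by linarith [(n.cast_nonneg : (0 : ℝ) ≤ n)])
    have h1 : ‖velocityContinuum j φ‖ = 2 * ‖partialContinuum j φ‖ := by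
      change ‖(-2 * Complex.I) • partialContinuum j φ‖ = _
      rw [norm_smul]
      simp
    have h2 : ‖(((n + 1 : ℂ)⁻¹) • (laplacianContinuum d).domain.subtype) φ‖
        ≤ ‖(φ : L2Continuum d)‖ := by
      change ‖((n + 1 : ℂ)⁻¹) • (φ : L2Continuum d)‖ ≤ _
      rw [norm_smul]
      exact mul_le_of_le_one_left (norm_nonneg _) hn
    have h3 := hC φ
    have h4 := norm_nonneg (schrodingerContinuum V hV φ)
    rw [h1]
    linarith
  · refine tendsto_phaseOp_apply (measurable_continuumCoordinate j) ?_
    have h : Tendsto (fun n : ℕ => ((n + 1 : ℂ)⁻¹)) atTop (𝓝 0) := by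
      simpa using tendsto_one_div_add_atTop_nhds_zero_nat (𝕜 := ℂ)
    have h1 := (h.smul_const (φ : L2Continuum d)).const_add (velocityContinuum j φ)
    rw [zero_smul, add_zero] at h1
    exact h1

end ContinuumVelocity

end BallisticTransport

end

/-! ### The theorem for both configuration spaces. -/

theorem mainTheorem6 (d : ℕ) :
    (∀ (V : EuclideanSpace ℝ (Fin d) → ℝ) (hV : MemLp V ∞ volume)
      (ψ φ : BallisticTransport.L2Continuum d),
      ψ ∈ BallisticTransport.absolutelyContinuousSubspace
        (BallisticTransport.schrodingerContinuum V hV) →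
      BallisticTransport.StrongBallisticTransport
        (BallisticTransport.schrodingerContinuum V hV)
        (BallisticTransport.positionContinuum d) ψ →
      φ ∈ BallisticTransport.purePointSubspace
        (BallisticTransport.schrodingerContinuum V hV) →
      φ ∈ (BallisticTransport.positionContinuum d).domain →
      φ ∈ (BallisticTransport.schrodingerContinuum V hV).domain →
      BallisticTransport.StrongBallisticTransport
        (BallisticTransport.schrodingerContinuum V hV)
        (BallisticTransport.positionContinuum d) (ψ + φ) ∧
      ∀ P, BallisticTransport.HasAsymptoticVelocity
          (BallisticTransport.schrodingerContinuum V hV)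
          (BallisticTransport.positionContinuum d) ψ P →
        BallisticTransport.HasAsymptoticVelocity
          (BallisticTransport.schrodingerContinuum V hV)
          (BallisticTransport.positionContinuum d) (ψ + φ) P) ∧
    (∀ (V : (Fin d → ℤ) → ℝ) (hV : MemLp V ∞ Measure.count)
      (ψ φ : BallisticTransport.L2Lattice d),
      ψ ∈ BallisticTransport.absolutelyContinuousSubspace
        (BallisticTransport.schrodingerLattice V hV) →
      BallisticTransport.StrongBallisticTransport
        (BallisticTransport.schrodingerLattice V hV)
        (BallisticTransport.positionLattice d) ψ →
      φ ∈ BallisticTransport.purePointSubspace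
        (BallisticTransport.schrodingerLattice V hV) →
      φ ∈ (BallisticTransport.positionLattice d).domain →
      BallisticTransport.StrongBallisticTransport
        (BallisticTransport.schrodingerLattice V hV)
        (BallisticTransport.positionLattice d) (ψ + φ) ∧
      ∀ P, BallisticTransport.HasAsymptoticVelocity
          (BallisticTransport.schrodingerLattice V hV)
          (BallisticTransport.positionLattice d) ψ P →
        BallisticTransport.HasAsymptoticVelocity
          (BallisticTransport.schrodingerLattice V hV)
          (BallisticTransport.positionLattice d) (ψ + φ) P) := by
  refine ⟨fun V hV ψ φ _ hψ hφ hφQ hφH => ?_, fun V hV ψ φ _ hψ hφ hφQ => ?_⟩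
  · exact hψ.add_purePoint (BallisticTransport.isStrongLimit_cutoffOp _)
      (BallisticTransport.isVelocityLimit_continuum V hV) hφ hφQ hφH
  · exact hψ.add_purePoint (BallisticTransport.isStrongLimit_cutoffOp _)
      (BallisticTransport.isVelocityLimit_lattice V hV) hφ hφQ trivial
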